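/- For graphs $F$ and $H$, let $R(F,H)$ be the smallest positive integer $N$ such that every red/blue colouring of the edges of the complete graph $K_N$ contains a red copy of $F$ or a blue copy of $H$ (as a not necessarily induced subgraph). Let $C_m$ be the cycle on $m$ vertices, and let $F_n$ be the fan on $2n+1$ vertices, which consists of $n$ triangles that share exactly one common vertex and are otherwise disjoint. Let $a\ge 1/2$ be a fixed real number. Then, as $n\to\infty$, $$R(C_{2\lfloor an\rfloor},F_n)=\begin{cases}(2+2a+o(1))\,n & \text{if } 1/2\le a<1,\\ (4a+o(1))\,n & \text{if } a\ge 1,\end{cases}$$ where $o(1)$ denotes a quantity (which may depend on $a$) that tends to $0$ as $n\to\infty$. -/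

import Mathlib

/-- `N` is a Ramsey bound for `(F, H)`: every red/blue colouring of the edges of the complete graph
on `N` vertices has a red copy of `F` or a blue copy of `H` (copies are not necessarily induced).
A colouring is given by its graph `R` of red edges; the blue edges are then those of `Rᶜ`. -/
def RamseyArrows {V W : Type} (F : SimpleGraph V) (H : SimpleGraph W) (N : ℕ) : Prop :=
  ∀ R : SimpleGraph (Fin N), F.IsContained R ∨ H.IsContained Rᶜ

/-- The Ramsey number `R(F, H)`: the smallest positive integer `N` with `RamseyArrows F H N`. -/
noncomputable def ramseyNumber {V W : Type} (F : SimpleGraph V) (H : SimpleGraph W) : ℕ :=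
  sInf {N : ℕ | 0 < N ∧ RamseyArrows F H N}

/-- The fan `F_n`, on `2n + 1` vertices: `n` triangles that share exactly the vertex `none`.
The `i`-th triangle has vertices `none`, `some (i, false)` and `some (i, true)`. -/
def fanGraph (n : ℕ) : SimpleGraph (Option (Fin n × Bool)) where
  Adj
    | none, none => False
    | none, some _ => True
    | some _, none => True
    | some x, some y => x.1 = y.1 ∧ x.2 ≠ y.2
  symm := ⟨by
    rintro (_ | x) (_ | y) h
    · exact h
    · trivial
    · trivial
    · exact ⟨h.1.symm, h.2.symm⟩⟩
  loopless := ⟨by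
    rintro (_ | x) h
    · exact h
    · exact h.2 rfl⟩

/-! Put m = ⌊an⌋. Both cases say that the Ramsey number is max(2n + 2m, 4m) up to o(n);
`ramseyNumber_bounds` proves this with error 40k above and 9 below, where k is a small multiple of
n. Lower bound: take disjoint red cliques of fewer than 2m vertices each, with all other edges blue.
Two of them have no blue triangle. With three, a blue triangle meets every clique, so a fan is
excluded once two of the cliques have fewer than n vertices. Upper bound (`ramseyArrows_of_le`): in
a colouring without a blue fan, every blue neighbourhood lacks a blue matching of size n. By
`exists_independent_of_no_matching`, it then contains a red clique U and a set W of fewer than n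
vertices, each joined in red to all but at most one vertex of U. A vertex of small red degree would
make U ∪ W large enough to hold a red cycle of length 2m, so all red degrees exceed m by a multiple
of k (`degree_lower_bound`). Deleting few vertices splits the red graph into at most six robustly
connected classes with only blue edges between them. A class with more than 2m + 2k vertices has the
cycle, so there are at least three classes. For a vertex of the smallest class, the union of the
other classes is a blue neighbourhood; the U and W found there lie in one class, and counting gives
N < 2n + 2m + 40k. The cycle comes from `exists_even_cycle`. A bounded hub is set aside, in which
almost every vertex has many neighbours; a rotation argument finds a path slightly shorter than 2m
outside it, and the hub closes this path while adjusting both length and parity. -/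

namespace SimpleGraph

/-! ### Paths as vertex lists -/

/-- The list `l` is the vertex list of a path of `G` from `u` to `v`. -/
def IsListPath {V : Type*} (G : SimpleGraph V) (u v : V) (l : List V) : Prop :=
  l.Nodup ∧ l.IsChain G.Adj ∧ l.head? = some u ∧ l.getLast? = some v

variable {V : Type*} {G : SimpleGraph V}

namespace IsListPath

lemma singleton (u : V) : G.IsListPath u u [u] := by simp [IsListPath]

lemma append {u v v' w : V} {l₁ l₂ : List V} (h₁ : G.IsListPath u v l₁)
    (h₂ : G.IsListPath v' w l₂) (hadj : G.Adj v v') (hd : ∀ x ∈ l₁, x ∉ l₂) :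
    G.IsListPath u w (l₁ ++ l₂) := by
  obtain ⟨n₁, c₁, a₁, b₁⟩ := h₁
  obtain ⟨n₂, c₂, a₂, b₂⟩ := h₂
  refine ⟨List.nodup_append.2 ⟨n₁, n₂, ?_⟩, c₁.append c₂ ?_, by simp [a₁], by simp [b₂]⟩
  · rintro x hx y hy rfl
    exact hd x hx hy
  · intro x hx y hy
    rw [b₁] at hx
    rw [a₂] at hy
    cases hx
    cases hy
    exact hadj

lemma reverse {u v : V} {l : List V} (h : G.IsListPath u v l) : G.IsListPath v u l.reverse := by
  obtain ⟨n, c, a, b⟩ := h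
  refine ⟨List.nodup_reverse.2 n, ?_, by simp [b], by simp [a]⟩
  rw [List.isChain_reverse]
  exact c.imp fun _ _ h => h.symm

lemma map {W : Type*} {H : SimpleGraph W} {u v : V} {l : List V} (h : G.IsListPath u v l)
    (f : G ↪g H) : H.IsListPath (f u) (f v) (l.map f) := by
  obtain ⟨n, c, a, b⟩ := h
  refine ⟨n.map f.injective, ?_, by simp [a], by simp [b]⟩
  rw [List.isChain_map]
  exact c.imp fun _ _ h => f.map_adj_iff.2 h

lemma left_mem {u v : V} {l : List V} (h : G.IsListPath u v l) : u ∈ l :=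
  List.mem_of_mem_head? h.2.2.1

/-- A path whose end vertices are adjacent closes to a cycle. -/
lemma cycleGraph_isContained {u v : V} {l : List V} (h : G.IsListPath u v l) (hadj : G.Adj v u) :
    (cycleGraph l.length).IsContained G := by
  obtain ⟨n, c, a, b⟩ := h
  have hne : l ≠ [] := by rintro rfl; simp at a
  have hpos : 0 < l.length := List.length_pos_of_ne_nil hne
  have h0 : l[0] = u := by
    rw [List.head?_eq_getElem?, List.getElem?_eq_getElem hpos] at a
    exact Option.some.inj a
  have hl : l[l.length - 1] = v := by
    rw [List.getLast?_eq_getElem?, List.getElem?_eq_getElem (by omega)] at b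
    exact Option.some.inj b
  -- Subtraction is cyclic: difference 1 means consecutive positions, or `i` first and `j` last,
  -- where the closing edge serves.
  have key : ∀ i j : Fin l.length, (i - j).val = 1 → G.Adj l[i.val] l[j.val] := by
    intro i j hij
    rcases le_or_gt j i with hle | hlt
    · rw [Fin.sub_val_of_le hle] at hij
      have : i.val = j.val + 1 := by omega
      have := c.getElem j.val (by omega)
      simp only [‹i.val = j.val + 1›]
      exact this.symm
    · rw [Fin.coe_sub_iff_lt.mpr hlt] at hij
      have hi : i.val = 0 := by have := j.2; omega
      have hj : j.val = l.length - 1 := by have := j.2; omega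
      simp only [hi, hj, h0, hl]
      exact hadj.symm
  refine ⟨⟨⟨fun i => l[i.val], ?_⟩, ?_⟩⟩
  · intro i j hij
    rcases cycleGraph_adj'.1 hij with h | h
    · exact key i j h
    · exact (key j i h).symm
  · intro i j hij
    exact Fin.ext ((List.Nodup.getElem_inj_iff n).1 hij)

end IsListPath

/-- Every nonempty list forming a path is a list path between its ends. -/
lemma isListPath_of_isChain {l : List V} (hn : l.Nodup) (hc : l.IsChain G.Adj) (h : l ≠ []) :
    G.IsListPath (l.head h) (l.getLast h) l :=
  ⟨hn, hc, List.head?_eq_some_head h, List.getLast?_eq_some_getLast h⟩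

/-- A short list path exists between any two vertices of a connected graph. -/
lemma Preconnected.exists_isListPath (hG : G.Preconnected) (u v : V) :
    ∃ l, G.IsListPath u v l ∧ l.length = G.dist u v + 1 := by
  obtain ⟨p, hp, hl⟩ := (hG u v).exists_path_of_dist
  refine ⟨p.support, ⟨hp.support_nodup, p.isChain_adj_support, ?_, ?_⟩, by simp [hl]⟩
  · rw [List.head?_eq_some_head p.support_ne_nil, p.head_support]
  · rw [List.getLast?_eq_some_getLast p.support_ne_nil, p.getLast_support]

/-! ### Minimum degree: distances and long paths -/

/-- In a connected graph, `d` times the minimum degree is at most three times the order if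
`d` is a distance between vertices. -/
lemma Preconnected.dist_mul_le [Fintype V] [DecidableRel G.Adj] (hG : G.Preconnected) {δ : ℕ}
    (hδ : ∀ v, δ ≤ G.degree v) (u v : V) : G.dist u v * δ ≤ 3 * Fintype.card V := by
  classical
  -- Every distance layer around `u` below `dist u v` contains a vertex, whose δ neighbours lie in
  -- that layer or the two adjacent ones. Summed over the layers, each vertex is counted at most
  -- three times.
  have hex : ∀ i ∈ Finset.range (G.dist u v), ∃ w, G.dist u w = i := by
    intro i hi
    rw [Finset.mem_range] at hi
    obtain ⟨p, hp⟩ := (hG u v).exists_walk_length_eq_dist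
    refine ⟨p.getVert i, le_antisymm ?_ ?_⟩
    · have := dist_le (p.take i)
      simpa [hp, hi.le] using this
    · have h1 := dist_le (p.drop i)
      have h2 := (hG u (p.getVert i)).dist_triangle_left v
      rw [Walk.drop_length] at h1
      omega
  have h1 : ∀ i ∈ Finset.range (G.dist u v),
      δ ≤ ∑ x : V, if i ≤ G.dist u x + 1 ∧ G.dist u x ≤ i + 1 then 1 else 0 := by
    intro i hi
    obtain ⟨w, hw⟩ := hex i hi
    refine (hδ w).trans ?_
    rw [← Finset.card_filter, ← card_neighborFinset_eq_degree]
    refine Finset.card_le_card fun x hx => ?_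
    rw [mem_neighborFinset] at hx
    have h2 := (hG u w).dist_triangle_left x
    have h3 := (hG u x).dist_triangle_left w
    rw [dist_eq_one_iff_adj.2 hx] at h2
    rw [dist_eq_one_iff_adj.2 hx.symm] at h3
    simp only [Finset.mem_filter, Finset.mem_univ, true_and]
    omega
  have h2 := Finset.card_nsmul_le_sum _ _ _ h1
  rw [Finset.card_range, smul_eq_mul, Finset.sum_comm] at h2
  refine h2.trans ?_
  have h3 : ∀ x ∈ (Finset.univ : Finset V), (∑ i ∈ Finset.range (G.dist u v),
      if i ≤ G.dist u x + 1 ∧ G.dist u x ≤ i + 1 then 1 else 0) ≤ 3 := by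
    intro x _
    rw [← Finset.card_filter]
    refine (Finset.card_le_card (t := Finset.Icc (G.dist u x - 1) (G.dist u x + 1)) ?_).trans ?_
    · intro i hi
      simp only [Finset.mem_filter, Finset.mem_Icc] at hi ⊢
      omega
    · rw [Nat.card_Icc]
      omega
  have h4 := Finset.sum_le_card_nsmul _ _ _ h3
  simpa [mul_comm] using h4

/-- In a connected graph, an edge leaves every nonempty proper vertex set. -/
lemma Preconnected.exists_adj_boundary (hG : G.Preconnected) {s : Set V} {x y : V}
    (hx : x ∈ s) (hy : y ∉ s) : ∃ a ∈ s, ∃ b ∉ s, G.Adj a b := by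
  obtain ⟨p⟩ := hG x y
  obtain ⟨d, -, h1, h2⟩ := p.exists_boundary_dart s hx hy
  exact ⟨d.fst, h1, d.snd, h2, d.adj⟩

/-- Connectedness gives an edge `ab` leaving the cycle formed by `l`. Cutting the cycle just after
`a` and appending `b` gains one vertex. -/
lemma exists_longer_path_of_closed (hG : G.Preconnected) {u v : V} {l : List V}
    (h : G.IsListPath u v l) (hadj : G.Adj v u) {z : V} (hz : z ∉ l) :
    ∃ l' : List V, l'.Nodup ∧ l'.IsChain G.Adj ∧ l'.length = l.length + 1 := by
  classical
  obtain ⟨a, ha, b, hb, hab⟩ := hG.exists_adj_boundary (s := {x | x ∈ l}) h.left_mem hz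
  simp only [Set.mem_ofPred_eq] at ha hb
  obtain ⟨l₁, l₂, rfl⟩ := List.append_of_mem ha
  obtain ⟨n, c, hu, hv⟩ := h
  refine ⟨l₂ ++ (l₁ ++ [a, b]), ?_, ?_, by simp; omega⟩
  · have hp : (l₂ ++ (l₁ ++ [a, b])).Perm (b :: (l₁ ++ a :: l₂)) := by
      rw [List.perm_iff_count]
      intro x
      simp [List.count_cons]
      omega
    rw [hp.nodup_iff, List.nodup_cons]
    exact ⟨hb, n⟩
  · have c1 := (List.isChain_append.1 c).1
    have c2 := (List.isChain_append.1 c).2.1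
    have c3 := (List.isChain_append.1 c).2.2
    refine c2.tail.append (c1.append (by simpa using hab) ?_) ?_
    · intro x hx y hy
      exact c3 x hx y (by simpa using hy)
    · intro x hx y hy
      rcases l₂ with _ | ⟨c, l₂⟩
      · simp at hx
      · have hxv : x = v := by
          simp at hv hx
          simp_all
        have hyu : y = u := by
          rcases l₁ with _ | ⟨d, l₁⟩ <;> simp_all
        rw [hxv, hyu]
        exact hadj

/-- Rotation argument of Dirac and Ore. If no end has a neighbour off the path, all neighbours of
both ends lie on it; two crossing chords then turn it into a cycle on the same vertices, and the
previous lemma applies. -/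
lemma exists_longer_path [Fintype V] [DecidableRel G.Adj] (hG : G.Preconnected) {δ : ℕ}
    (hδ : ∀ v, δ ≤ G.degree v) (hcard : 2 * δ < Fintype.card V) {l : List V} (hn : l.Nodup)
    (hc : l.IsChain G.Adj) (hl : l.length ≤ 2 * δ) :
    ∃ l' : List V, l'.Nodup ∧ l'.IsChain G.Adj ∧ l'.length = l.length + 1 := by
  classical
  rcases eq_or_ne l [] with rfl | hne
  · have : 0 < Fintype.card V := by omega
    obtain ⟨v⟩ := Fintype.card_pos_iff.1 this
    exact ⟨[v], by simp⟩
  have hpos : 0 < l.length := List.length_pos_of_ne_nil hne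
  by_cases hfst : ∃ z ∉ l, G.Adj (l.head hne) z
  · obtain ⟨z, hz, hadj⟩ := hfst
    refine ⟨z :: l, List.nodup_cons.2 ⟨hz, hn⟩, hc.cons ?_, rfl⟩
    intro y hy
    rw [List.head?_eq_some_head hne] at hy
    cases hy
    exact hadj.symm
  by_cases hlst : ∃ z ∉ l, G.Adj (l.getLast hne) z
  · obtain ⟨z, hz, hadj⟩ := hlst
    have := (isListPath_of_isChain hn hc hne).append (IsListPath.singleton z) hadj
      (by rintro x hx hx'; simp at hx'; exact hz (hx' ▸ hx))
    exact ⟨l ++ [z], this.1, this.2.1, by simp⟩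
  push Not at hfst hlst
  have hz : ∃ z, z ∉ l := by
    by_contra! hall
    have : Fintype.card V ≤ l.toFinset.card :=
      Finset.card_le_card fun x _ => List.mem_toFinset.2 (hall x)
    rw [List.toFinset_card_of_nodup hn] at this
    omega
  obtain ⟨z, hz⟩ := hz
  have h0 : l.head hne = l[0] := List.head_eq_getElem hne
  have hlast : l.getLast hne = l[l.length - 1] := List.getLast_eq_getElem hne
  set d := l[0] with hd
  have hgetD : ∀ i (hi : i < l.length), l.getD i d = l[i] := fun i hi => by
    simp [List.getD_eq_getElem?_getD, hi]
  -- `S` is shifted by one: an index in both `S` and `T` gives chords from the head to position i +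
  -- 1 and from the last vertex to position i. Two sets of size at least δ among at most 2δ - 1
  -- indices must meet.
  set S := (Finset.range (l.length - 1)).filter fun i => G.Adj (l.head hne) (l.getD (i + 1) d)
  set T := (Finset.range (l.length - 1)).filter fun i => G.Adj (l.getLast hne) (l.getD i d)
  have hS : δ ≤ S.card := by
    refine (hδ (l.head hne)).trans ?_
    rw [← card_neighborFinset_eq_degree]
    refine (Finset.card_le_card (t := S.image fun i => l.getD (i + 1) d) ?_).trans
      Finset.card_image_le
    intro x hx
    rw [mem_neighborFinset] at hx
    have hxl : x ∈ l := by by_contra h; exact hfst x h hx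
    obtain ⟨i, hi, rfl⟩ := List.getElem_of_mem hxl
    have hi0 : i ≠ 0 := by
      rintro rfl
      rw [h0] at hx
      exact G.irrefl hx
    refine Finset.mem_image.2 ⟨i - 1, Finset.mem_filter.2 ⟨Finset.mem_range.2 (by omega), ?_⟩, ?_⟩
    · rw [Nat.sub_add_cancel (by omega), hgetD i hi]
      exact hx
    · rw [Nat.sub_add_cancel (by omega), hgetD i hi]
  have hT : δ ≤ T.card := by
    refine (hδ (l.getLast hne)).trans ?_
    rw [← card_neighborFinset_eq_degree]
    refine (Finset.card_le_card (t := T.image fun i => l.getD i d) ?_).trans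
      Finset.card_image_le
    intro x hx
    rw [mem_neighborFinset] at hx
    have hxl : x ∈ l := by by_contra h; exact hlst x h hx
    obtain ⟨i, hi, rfl⟩ := List.getElem_of_mem hxl
    have hi0 : i ≠ l.length - 1 := by
      rintro rfl
      rw [hlast] at hx
      exact G.irrefl hx
    refine Finset.mem_image.2 ⟨i, Finset.mem_filter.2 ⟨Finset.mem_range.2 (by omega), ?_⟩, ?_⟩
    · rw [hgetD i hi]
      exact hx
    · rw [hgetD i hi]
  have hinter : (S ∩ T).Nonempty := by
    rw [← Finset.card_pos]
    have h1 := Finset.card_union_add_card_inter S T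
    have h2 : (S ∪ T).card ≤ l.length - 1 := by
      rw [← Finset.card_range (l.length - 1)]
      exact Finset.card_le_card (Finset.union_subset (Finset.filter_subset _ _)
        (Finset.filter_subset _ _))
    omega
  obtain ⟨i, hi⟩ := hinter
  rw [Finset.mem_inter, Finset.mem_filter, Finset.mem_filter, Finset.mem_range] at hi
  obtain ⟨⟨hi, hiS⟩, -, hiT⟩ := hi
  rw [hgetD _ (by omega)] at hiS hiT
  have e1 : G.IsListPath (l.head hne) l[i] (l.take (i + 1)) := by
    refine ⟨hn.sublist (List.take_sublist _ _), hc.take _, ?_, ?_⟩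
    · rw [List.head?_take, List.head?_eq_some_head hne]; simp
    · rw [List.getLast?_take]; simp [show i < l.length by omega]
  have e2 : G.IsListPath l[i + 1] (l.getLast hne) (l.drop (i + 1)) := by
    refine ⟨hn.sublist (List.drop_sublist _ _), hc.drop _, ?_, ?_⟩
    · rw [List.head?_drop, List.getElem?_eq_getElem (by omega)]
    · rw [List.getLast?_drop, List.getLast?_eq_some_getLast hne, if_neg (by omega)]
  have hdisj : ∀ x ∈ l.take (i + 1), x ∉ (l.drop (i + 1)).reverse := by
    intro x hx hx'
    rw [← List.take_append_drop (i + 1) l, List.nodup_append] at hn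
    exact hn.2.2 x hx x (List.mem_reverse.1 hx') rfl
  have e3 := e1.append e2.reverse hiT.symm hdisj
  have hzz : z ∉ l.take (i + 1) ++ (l.drop (i + 1)).reverse := by
    intro h
    rw [List.mem_append, List.mem_reverse, ← List.mem_append, List.take_append_drop] at h
    exact hz h
  obtain ⟨l', a, b, c⟩ := exists_longer_path_of_closed hG e3 hiS.symm hzz
  refine ⟨l', a, b, ?_⟩
  rw [c]
  simp
  omega

/-- A connected graph of minimum degree at least `δ` on more than `2δ` vertices has a path on
`q` vertices for every `q ≤ 2δ + 1`. -/
theorem exists_path_of_minDegree [Fintype V] [DecidableRel G.Adj] (hG : G.Preconnected) {δ : ℕ}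
    (hδ : ∀ v, δ ≤ G.degree v) (hcard : 2 * δ < Fintype.card V) {q : ℕ} (hq : q ≤ 2 * δ + 1) :
    ∃ l : List V, l.Nodup ∧ l.IsChain G.Adj ∧ l.length = q := by
  induction q with
  | zero => exact ⟨[], by simp⟩
  | succ q ih =>
    obtain ⟨l, hn, hc, hl⟩ := ih (by omega)
    obtain ⟨l', hn', hc', hl'⟩ := exists_longer_path hG hδ hcard hn hc (by omega)
    exact ⟨l', hn', hc', by omega⟩

lemma degree_le_degree_induce_add_card [Fintype V] [DecidableRel G.Adj] (S : Finset V)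
    [Fintype {x | x ∉ S}] [DecidableRel (G.induce {x | x ∉ S}).Adj] (v : {x | x ∉ S}) :
    G.degree v ≤ (G.induce {x | x ∉ S}).degree v + S.card := by
  classical
  rw [← card_neighborFinset_eq_degree, ← card_neighborFinset_eq_degree]
  refine (Finset.card_le_card
    (t := ((G.induce {x | x ∉ S}).neighborFinset v).image Subtype.val ∪ S) ?_).trans
    ((Finset.card_union_le _ _).trans (Nat.add_le_add_right Finset.card_image_le _))
  intro x hx
  rw [mem_neighborFinset] at hx
  by_cases hxS : x ∈ S
  · exact Finset.mem_union_right _ hxS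
  · exact Finset.mem_union_left _ (Finset.mem_image.2
      ⟨⟨x, hxS⟩, by rw [mem_neighborFinset]; exact hx, rfl⟩)

/-! ### Robust connectivity, dominating sets and linkages -/

/-- The graph stays connected after the removal of any `k` vertices. -/
def IsRobust (G : SimpleGraph V) (k : ℕ) : Prop :=
  ∀ S : Finset V, S.card ≤ k → (G.induce {x | x ∉ S}).Preconnected

/-- Any two vertices outside a set `S` of at most `k` vertices are joined by a path on at most `M`
vertices avoiding `S`. -/
def IsLinked (G : SimpleGraph V) (k M : ℕ) : Prop :=
  ∀ S : Finset V, S.card ≤ k → ∀ u v, u ∉ S → v ∉ S →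
    ∃ l, G.IsListPath u v l ∧ l.length ≤ M ∧ ∀ x ∈ l, x ∉ S

/-- After the removal of `S` the graph is connected with minimum degree at least k on at most Qk
vertices, so `dist_mul_le` bounds distances by 3Q. -/
lemma IsRobust.isLinked [Fintype V] [DecidableRel G.Adj] {k Q : ℕ} (hG : G.IsRobust k)
    (hk : 0 < k) (hV : Fintype.card V ≤ Q * k) (hδ : ∀ v, 2 * k ≤ G.degree v) :
    G.IsLinked k (3 * Q + 1) := by
  classical
  intro S hS u v hu hv
  obtain ⟨l, hl, hlen⟩ := (hG S hS).exists_isListPath ⟨u, hu⟩ ⟨v, hv⟩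
  have h1 := (hG S hS).dist_mul_le (δ := k) (fun w => by
    have := degree_le_degree_induce_add_card (G := G) S w
    have := hδ w
    omega) ⟨u, hu⟩ ⟨v, hv⟩
  have h2 : Fintype.card {x | x ∉ S} ≤ Fintype.card V := Fintype.card_subtype_le _
  have h3 := Nat.le_of_mul_le_mul_right
    (h1.trans ((Nat.mul_le_mul_left 3 (h2.trans hV)).trans_eq (mul_assoc 3 Q k).symm)) hk
  refine ⟨l.map Subtype.val, hl.map (Embedding.induce _), by simp; omega, ?_⟩
  intro x hx
  obtain ⟨y, -, rfl⟩ := List.mem_map.1 hx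
  exact y.2

/-- A dense graph has a bounded set of vertices in which nearly all vertices have at least seven
neighbours. -/
lemma exists_dominating [Fintype V] [DecidableEq V] [DecidableRel G.Adj] {k Q : ℕ} (hQ : 0 < Q)
    (hk : 12 ≤ k) (hV : Fintype.card V ≤ Q * k) (hδ : ∀ v, k ≤ G.degree v) :
    ∃ H : Finset V, H.card ≤ 28 * Q ^ 2 ∧
      2 * (Finset.univ.filter fun v => (G.neighborFinset v ∩ H).card < 7).card ≤ k := by
  -- `Φ` is the total shortfall from seven neighbours. Take `H` minimising 4QΦ(H) + k|H|: comparison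
  -- with ∅ bounds its size, and comparison with H ∪ {h} shows that each `h` outside is adjacent to
  -- at most k/(4Q) deficient vertices.
  set Φ : Finset V → ℕ := fun H => ∑ v, (7 - (G.neighborFinset v ∩ H).card) with hΦ
  obtain ⟨H, -, hH⟩ := Finset.exists_min_image (Finset.univ : Finset (Finset V))
    (fun H => 4 * Q * Φ H + k * H.card) ⟨∅, Finset.mem_univ _⟩
  have hH' : ∀ H', 4 * Q * Φ H + k * H.card ≤ 4 * Q * Φ H' + k * H'.card :=
    fun H' => hH H' (Finset.mem_univ _)
  refine ⟨H, ?_, ?_⟩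
  · have h0 := hH' ∅
    have h1 : Φ ∅ = Fintype.card V * 7 := by simp [hΦ]
    rw [h1, Finset.card_empty] at h0
    have h2 : k * H.card ≤ k * (28 * Q ^ 2) := by
      calc k * H.card ≤ 4 * Q * (Fintype.card V * 7) := by omega
        _ ≤ 4 * Q * (Q * k * 7) := by gcongr
        _ = k * (28 * Q ^ 2) := by ring
    exact Nat.le_of_mul_le_mul_left h2 (by omega)
  · set D := Finset.univ.filter fun v => (G.neighborFinset v ∩ H).card < 7 with hD
    have hgain : ∀ h ∈ Finset.univ \ H, 4 * Q * (D.filter fun v => G.Adj v h).card ≤ k := by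
      intro h hh
      have hhH : h ∉ H := (Finset.mem_sdiff.1 hh).2
      have h1 : Φ (insert h H) + (D.filter fun v => G.Adj v h).card ≤ Φ H := by
        rw [hΦ, hD, Finset.filter_filter, Finset.card_filter, ← Finset.sum_add_distrib]
        refine Finset.sum_le_sum fun v _ => ?_
        have hle : (G.neighborFinset v ∩ H).card ≤ (G.neighborFinset v ∩ insert h H).card :=
          Finset.card_le_card (Finset.inter_subset_inter_left (Finset.subset_insert _ _))
        split_ifs with hv
        · have : (G.neighborFinset v ∩ insert h H).card = (G.neighborFinset v ∩ H).card + 1 := by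
            rw [Finset.inter_insert_of_mem (by rw [mem_neighborFinset]; exact hv.2),
              Finset.card_insert_of_notMem (by simp [hhH])]
          omega
        · omega
      have h2 := hH' (insert h H)
      rw [Finset.card_insert_of_notMem hhH] at h2
      have h3 := Nat.mul_le_mul_left (4 * Q) h1
      rw [mul_add] at h3
      rw [mul_add] at h2
      omega
    -- A deficient vertex has at most six neighbours in `H`, hence at least k - 6 ≥ k/2 outside.
    -- Double counting these edges against `hgain` gives |D| ≤ k/2.
    have hlow : ∀ v ∈ D, k - 6 ≤ ((Finset.univ \ H).filter fun h => G.Adj v h).card := by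
      intro v hv
      have h1 : (G.neighborFinset v ∩ H).card < 7 := (Finset.mem_filter.1 hv).2
      have h2 := hδ v
      rw [← card_neighborFinset_eq_degree] at h2
      have h3 := Finset.card_inter_add_card_sdiff (G.neighborFinset v) H
      have h4 : (G.neighborFinset v \ H).card ≤
          ((Finset.univ \ H).filter fun h => G.Adj v h).card := by
        refine Finset.card_le_card fun x hx => ?_
        simpa [and_comm] using hx
      omega
    have hdc : ∑ v ∈ D, ((Finset.univ \ H).filter fun h => G.Adj v h).card =
        ∑ h ∈ Finset.univ \ H, (D.filter fun v => G.Adj v h).card :=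
      Finset.sum_card_bipartiteAbove_eq_sum_card_bipartiteBelow _
    have h1 := Finset.card_nsmul_le_sum _ _ _ hlow
    have h2 := Finset.sum_le_card_nsmul _ _ _ hgain
    rw [hdc] at h1
    rw [← Finset.mul_sum] at h2
    have h3 : (Finset.univ \ H).card ≤ Q * k := (Finset.card_le_univ _).trans hV
    simp only [smul_eq_mul] at h1 h2
    have h4 : 4 * Q * (D.card * (k - 6)) ≤ Q * k * k :=
      (Nat.mul_le_mul_left _ h1).trans (h2.trans (Nat.mul_le_mul_right _ h3))
    have h5 : (2 * D.card) * (Q * k) ≤ k * (Q * k) := by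
      have h6 : k ≤ 2 * (k - 6) := by omega
      calc (2 * D.card) * (Q * k) ≤ (2 * D.card) * (Q * (2 * (k - 6))) := by gcongr
        _ = 4 * Q * (D.card * (k - 6)) := by ring
        _ ≤ Q * k * k := h4
        _ = k * (Q * k) := by ring
    exact Nat.le_of_mul_le_mul_right h5 (by positivity)

/-- A dense graph contains large complete bipartite graphs avoiding a given small set. -/
lemma exists_completeBipartite [Fintype V] [Nonempty V] [DecidableEq V] [DecidableRel G.Adj]
    {k Q s : ℕ} (hQ : 0 < Q) (hs : 0 < s) (hk : 8 * Q * s ≤ k)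
    (hk' : 4 * ((4 * Q * s).choose s * s) < k) (hV : Fintype.card V ≤ Q * k)
    (hδ : ∀ v, 2 * k ≤ G.degree v) (F : Finset V) (hF : F.card ≤ k) :
    ∃ A B : Finset V, Disjoint A F ∧ Disjoint B F ∧ Disjoint A B ∧ A.card = s ∧ B.card = s ∧
      ∀ a ∈ A, ∀ b ∈ B, G.Adj a b := by
  obtain ⟨v₀⟩ := ‹Nonempty V›
  have hV' : 2 * k ≤ Fintype.card V := (hδ v₀).trans (G.degree_lt_card_verts v₀).le
  -- Kővári–Sós–Turán with one side confined to a bounded set `T`. The size 4Qs makes at least k/4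
  -- vertices of `Y` have s neighbours in `T`; by pigeonhole over the s-subsets of `T`, many share
  -- the same s neighbours.
  obtain ⟨T, hTF, hT⟩ : ∃ T ⊆ Finset.univ \ F, T.card = 4 * Q * s := by
    refine Finset.exists_subset_card_eq ?_
    rw [Finset.card_sdiff_of_subset (Finset.subset_univ _), Finset.card_univ]
    have : 4 * Q * s ≤ k := by nlinarith
    omega
  set Y := Finset.univ \ (F ∪ T) with hY
  set Y' := Y.filter fun y => s ≤ (T.filter fun t => G.Adj t y).card with hY'
  have hlow : ∀ t ∈ T, k ≤ 2 * (Y.filter fun y => G.Adj t y).card := by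
    intro t ht
    have h1 := hδ t
    rw [← card_neighborFinset_eq_degree] at h1
    have h2 : (G.neighborFinset t).card ≤ (Y.filter fun y => G.Adj t y).card + (F ∪ T).card := by
      refine (Finset.card_le_card (t := (Y.filter fun y => G.Adj t y) ∪ (F ∪ T)) ?_).trans
        (Finset.card_union_le _ _)
      intro x hx
      rw [mem_neighborFinset] at hx
      by_cases h : x ∈ F ∪ T
      · exact Finset.mem_union_right _ h
      · exact Finset.mem_union_left _ (Finset.mem_filter.2 ⟨by simp [hY, h], hx⟩)
    have h3 := Finset.card_union_le F T
    have h4 : 8 * Q * s = 2 * (4 * Q * s) := by ring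
    omega
  have hdc : ∑ t ∈ T, (Y.filter fun y => G.Adj t y).card =
      ∑ y ∈ Y, (T.filter fun t => G.Adj t y).card :=
    Finset.sum_card_bipartiteAbove_eq_sum_card_bipartiteBelow _
  have h1 := Finset.card_nsmul_le_sum _ _ _ hlow
  rw [← Finset.mul_sum, hdc, smul_eq_mul] at h1
  have h2 : ∑ y ∈ Y, (T.filter fun t => G.Adj t y).card ≤ Y'.card * T.card + Y.card * s := by
    rw [← Finset.sum_filter_add_sum_filter_not Y
      fun y => s ≤ (T.filter fun t => G.Adj t y).card]
    refine add_le_add ?_ ?_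
    · rw [← smul_eq_mul]
      exact Finset.sum_le_card_nsmul _ _ _ fun y _ => Finset.card_filter_le _ _
    · refine (Finset.sum_le_card_nsmul _ _ s fun y hy => ?_).trans ?_
      · exact (not_le.1 (Finset.mem_filter.1 hy).2).le
      · rw [smul_eq_mul]
        exact Nat.mul_le_mul_right _ (Finset.card_filter_le _ _)
  have h3 : Y.card ≤ Q * k := (Finset.card_le_univ _).trans hV
  have h4 : k ≤ 4 * Y'.card := by
    rw [hT] at h1 h2
    have h5 : (Q * s) * (4 * k) ≤ (Q * s) * (8 * Y'.card + 2 * k) := by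
      have : Y.card * s ≤ Q * k * s := Nat.mul_le_mul_right _ h3
      nlinarith
    have := Nat.le_of_mul_le_mul_left h5 (by positivity)
    omega
  have hch : ∀ y ∈ Y', ∃ P ∈ T.powersetCard s, ∀ t ∈ P, G.Adj t y := by
    intro y hy
    obtain ⟨P, hP, hPs⟩ := Finset.exists_subset_card_eq (Finset.mem_filter.1 hy).2
    exact ⟨P, Finset.mem_powersetCard.2 ⟨hP.trans (Finset.filter_subset _ _), hPs⟩,
      fun t ht => (Finset.mem_filter.1 (hP ht)).2⟩
  choose! g hg hg' using hch
  obtain ⟨A, hA, hB⟩ := Finset.exists_lt_card_fiber_of_mul_lt_card_of_maps_to (n := s) hg (by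
    rw [Finset.card_powersetCard, hT]; omega)
  obtain ⟨B, hBs, hBc⟩ := Finset.exists_subset_card_eq hB.le
  have hAT := (Finset.mem_powersetCard.1 hA).1
  have hBY : ∀ b ∈ B, b ∈ Y' ∧ g b = A := fun b hb => Finset.mem_filter.1 (hBs hb)
  have hBY' : ∀ b ∈ B, b ∉ F ∪ T := fun b hb => by
    have := (Finset.mem_filter.1 (hBY b hb).1).1
    exact (Finset.mem_sdiff.1 this).2
  refine ⟨A, B, ?_, ?_, ?_, (Finset.mem_powersetCard.1 hA).2, hBc, ?_⟩
  · exact Finset.disjoint_left.2 fun x hx => (Finset.mem_sdiff.1 (hTF (hAT hx))).2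
  · exact Finset.disjoint_left.2 fun x hx h => hBY' x hx (Finset.mem_union_left _ h)
  · exact Finset.disjoint_right.2 fun x hx h => hBY' x hx (Finset.mem_union_right _ (hAT h))
  · intro a ha b hb
    exact hg' b (hBY b hb).1 a ((hBY b hb).2 ▸ ha)

/-- Zigzag paths in a complete bipartite graph. -/
lemma exists_zigzag [DecidableEq V] {j : ℕ} {A B : Finset V} (hAB : Disjoint A B)
    (hadj : ∀ a ∈ A, ∀ b ∈ B, G.Adj a b) (hA : j ≤ A.card) (hB : j < B.card) :
    ∃ l, ∃ b ∈ B, ∃ b' ∈ B, G.IsListPath b b' l ∧ l.length = 2 * j + 1 ∧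
      ∀ x ∈ l, x ∈ A ∨ x ∈ B := by
  induction j generalizing A B with
  | zero =>
    obtain ⟨b, hb⟩ := Finset.card_pos.1 hB
    exact ⟨[b], b, hb, b, hb, IsListPath.singleton b, rfl, by simp [hb]⟩
  | succ j ih =>
    obtain ⟨b, hb⟩ := Finset.card_pos.1 (show 0 < B.card by omega)
    obtain ⟨a, ha⟩ := Finset.card_pos.1 (show 0 < A.card by omega)
    obtain ⟨l, c, hc, c', hc', hl, hlen, hmem⟩ := ih (A := A.erase a) (B := B.erase b)
      (hAB.mono (Finset.erase_subset _ _) (Finset.erase_subset _ _))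
      (fun x hx y hy => hadj x (Finset.mem_of_mem_erase hx) y (Finset.mem_of_mem_erase hy))
      (by rw [Finset.card_erase_of_mem ha]; omega) (by rw [Finset.card_erase_of_mem hb]; omega)
    have hna : a ∉ B := Finset.disjoint_left.1 hAB ha
    have hnb : b ∉ A := Finset.disjoint_right.1 hAB hb
    have h1 : G.IsListPath a c' ([a] ++ l) := (IsListPath.singleton a).append hl
      (hadj a ha c (Finset.mem_of_mem_erase hc)) (by
        intro x hx hxl
        rw [List.mem_singleton] at hx
        subst hx
        rcases hmem x hxl with h | h
        · exact Finset.notMem_erase _ _ h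
        · exact hna (Finset.mem_of_mem_erase h))
    have h2 : G.IsListPath b c' ([b] ++ ([a] ++ l)) := (IsListPath.singleton b).append h1
      (hadj a ha b hb).symm (by
        intro x hx hxl
        rw [List.mem_singleton] at hx
        subst hx
        rw [List.mem_append, List.mem_singleton] at hxl
        rcases hxl with rfl | hxl
        · exact hna hb
        rcases hmem x hxl with h | h
        · exact hnb (Finset.mem_of_mem_erase h)
        · exact Finset.notMem_erase _ _ h)
    refine ⟨_, b, hb, c', Finset.mem_of_mem_erase hc', h2, by simp [hlen]; omega, ?_⟩
    intro x hx
    simp only [List.cons_append, List.nil_append, List.mem_cons] at hx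
    rcases hx with rfl | rfl | hx
    · exact Or.inr hb
    · exact Or.inl ha
    · exact (hmem x hx).imp Finset.mem_of_mem_erase Finset.mem_of_mem_erase

/-- Disjoint short paths joining each vertex `h` of a small set `H` to a prescribed vertex `a h`,
meeting a small set `F` in their ends only. -/
lemma IsLinked.exists_linkage [DecidableEq V] {k M : ℕ} (hG : G.IsLinked k M) {H F : Finset V}
    {a : V → V} (hHF : H ⊆ F) (haF : ∀ h ∈ H, a h ∈ F)
    (hinj : ∀ h ∈ H, ∀ h' ∈ H, a h = a h' → h = h') (hne : ∀ h ∈ H, a h ∉ H)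
    (hcard : F.card + H.card * M ≤ k) :
    ∃ L : V → List V, (∀ h ∈ H, G.IsListPath h (a h) (L h) ∧ (L h).length ≤ M ∧
      ∀ x ∈ L h, x ∈ F → x = h ∨ x = a h) ∧
      ∀ h ∈ H, ∀ h' ∈ H, h ≠ h' → ∀ x ∈ L h, x ∉ L h' := by
  suffices key : ∀ H' ⊆ H, ∃ L : V → List V, (∀ h ∈ H', G.IsListPath h (a h) (L h) ∧
      (L h).length ≤ M ∧ ∀ x ∈ L h, x ∈ F → x = h ∨ x = a h) ∧
      ∀ h ∈ H', ∀ h' ∈ H', h ≠ h' → ∀ x ∈ L h, x ∉ L h' from key H subset_rfl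
  intro H'
  induction H' using Finset.induction_on with
  | empty => exact fun _ => ⟨fun _ => [], by simp, by simp⟩
  | insert h H' hh ih =>
    intro hsub
    have hH' : H' ⊆ H := (Finset.subset_insert _ _).trans hsub
    have hhH : h ∈ H := hsub (Finset.mem_insert_self _ _)
    obtain ⟨L, hL, hL'⟩ := ih hH'
    -- The paths are chosen greedily: the next one avoids all earlier paths and all of `F` except
    -- its own ends.
    set S := F \ {h, a h} ∪ H'.biUnion fun h' => (L h').toFinset with hS
    have hScard : S.card ≤ k := by
      have h1 : (H'.biUnion fun h' => (L h').toFinset).card ≤ H'.card * M :=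
        Finset.card_biUnion_le_card_mul _ _ _ fun h' hh' =>
          (List.toFinset_card_le _).trans (hL h' hh').2.1
      have h2 := Finset.card_union_le (F \ {h, a h}) (H'.biUnion fun h' => (L h').toFinset)
      have h3 := Finset.card_le_card (Finset.sdiff_subset (s := F) (t := {h, a h}))
      have h4 := Nat.mul_le_mul_right M (Finset.card_le_card hH')
      rw [hS]
      omega
    have hend : ∀ x ∈ F, (x = h ∨ x = a h) → x ∉ S := by
      intro x hxF hx hxS
      rcases Finset.mem_union.1 hxS with h1 | h1
      · exact (Finset.mem_sdiff.1 h1).2 (by simpa using hx)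
      · obtain ⟨h', hh', hxL⟩ := Finset.mem_biUnion.1 h1
        have hne' : h' ≠ h := by rintro rfl; exact hh hh'
        rcases hx with rfl | rfl <;>
          rcases (hL h' hh').2.2 _ (List.mem_toFinset.1 hxL) hxF with h2 | h2
        · exact hne' h2.symm
        · exact hne h' (hH' hh') (h2 ▸ hhH)
        · exact hne h hhH (h2 ▸ hH' hh')
        · exact hne' (hinj h' (hH' hh') h hhH h2.symm)
    obtain ⟨l, hl, hlen, hlS⟩ := hG S hScard h (a h) (hend h (hHF hhH) (Or.inl rfl))
      (hend (a h) (haF h hhH) (Or.inr rfl))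
    have hlL : ∀ h' ∈ H', ∀ x ∈ l, x ∉ L h' := fun h' hh' x hx hxL =>
      hlS x hx (Finset.mem_union_right _ (Finset.mem_biUnion.2 ⟨h', hh', List.mem_toFinset.2 hxL⟩))
    have hupd : ∀ h' ∈ H', Function.update L h l h' = L h' := fun h' hh' =>
      Function.update_of_ne (by rintro rfl; exact hh hh') _ _
    refine ⟨Function.update L h l, ?_, ?_⟩
    · intro h' hh'
      rcases Finset.mem_insert.1 hh' with rfl | hh'
      · rw [Function.update_self]
        refine ⟨hl, hlen, fun x hx hxF => ?_⟩
        by_contra hcon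
        exact hlS x hx (Finset.mem_union_left _ (Finset.mem_sdiff.2 ⟨hxF, by simpa using hcon⟩))
      · rw [hupd h' hh']
        exact hL h' hh'
    · intro h₁ hm₁ h₂ hm₂ hne₁₂ x hx
      rcases Finset.mem_insert.1 hm₁ with rfl | hh₁ <;>
        rcases Finset.mem_insert.1 hm₂ with rfl | hh₂
      · exact absurd rfl hne₁₂
      · rw [Function.update_self] at hx
        rw [hupd _ hh₂]
        exact hlL _ hh₂ x hx
      · rw [Function.update_self]
        rw [hupd _ hh₁] at hx
        exact fun hxl => hlL _ hh₁ x hxl hx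
      · rw [hupd _ hh₁] at hx
        rw [hupd _ hh₂]
        exact hL' _ hh₁ _ hh₂ hne₁₂ x hx

lemma isListPath_take {l : List V} (hn : l.Nodup) (hc : l.IsChain G.Adj) {i : ℕ}
    (hi : i < l.length) : G.IsListPath l[0] l[i] (l.take (i + 1)) := by
  refine ⟨hn.sublist (List.take_sublist _ _), hc.take _, ?_, ?_⟩
  · rw [List.head?_take, List.head?_eq_getElem?, List.getElem?_eq_getElem (by omega)]
    simp
  · rw [List.getLast?_take]
    simp [hi]

lemma isListPath_drop {l : List V} (hn : l.Nodup) (hc : l.IsChain G.Adj) {i : ℕ}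
    (hi : i < l.length) : G.IsListPath l[i] l[l.length - 1] (l.drop i) := by
  refine ⟨hn.sublist (List.drop_sublist _ _), hc.drop _, ?_, ?_⟩
  · rw [List.head?_drop, List.getElem?_eq_getElem hi]
  · rw [List.getLast?_drop, if_neg (by omega), List.getLast?_eq_getElem?,
      List.getElem?_eq_getElem (by omega)]

/-! ### Hubs and even cycles of prescribed length -/

/-- A hub: disjoint paths `L h` from the vertices `h` of `H` to terminals in one side of a complete
bipartite graph with sides `A ∪ {terminals}` and `B`. -/
structure Hub (G : SimpleGraph V) (M : ℕ) where
  /-- the entry vertices -/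
  H : Finset V
  /-- the terminals -/
  a : V → V
  /-- the paths from the entry vertices to their terminals -/
  L : V → List V
  /-- the free vertices on the side of the terminals -/
  A : Finset V
  /-- the other side -/
  B : Finset V
  isListPath : ∀ h ∈ H, G.IsListPath h (a h) (L h)
  length_le : ∀ h ∈ H, (L h).length ≤ M
  disjoint : ∀ h ∈ H, ∀ h' ∈ H, h ≠ h' → ∀ x ∈ L h, x ∉ L h'
  notMem_A : ∀ h ∈ H, ∀ x ∈ L h, x ∉ A
  notMem_B : ∀ h ∈ H, ∀ x ∈ L h, x ∉ B
  adj_terminal : ∀ h ∈ H, ∀ b ∈ B, G.Adj (a h) b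
  adj : ∀ a ∈ A, ∀ b ∈ B, G.Adj a b
  disjoint_AB : Disjoint A B
  card_A : 2 * M + 8 ≤ A.card
  card_B : 2 * M + 8 ≤ B.card

namespace Hub

variable {M : ℕ}

/-- Being outside the hub. -/
def Avoids (Z : Hub G M) (x : V) : Prop := (∀ h ∈ Z.H, x ∉ Z.L h) ∧ x ∉ Z.A ∧ x ∉ Z.B

/-- A path whose ends are adjacent to entry vertices of the hub is closed to a cycle of prescribed
length through the hub. -/
lemma close [DecidableEq V] (Z : Hub G M) {m : ℕ} {u v b₀ h₀ h₁ : V} {P : List V}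
    (hP : G.IsListPath u v P) (hh₀ : h₀ ∈ Z.H) (hh₁ : h₁ ∈ Z.H) (hne : h₀ ≠ h₁)
    (hu : G.Adj u h₀) (hv : G.Adj v h₁)
    (hPL₀ : ∀ x ∈ P, x ∉ Z.L h₀) (hPL₁ : ∀ x ∈ P, x ∉ Z.L h₁) (hPA : ∀ x ∈ P, x ∉ Z.A)
    (hPB : ∀ x ∈ P, x ∈ Z.B → x = b₀)
    (hodd : (P.length + (Z.L h₀).length + (Z.L h₁).length) % 2 = 1)
    (hlow : P.length + (Z.L h₀).length + (Z.L h₁).length ≤ 2 * m)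
    (hhigh : 2 * m ≤ P.length + (Z.L h₀).length + (Z.L h₁).length + 4 * M + 10) :
    (cycleGraph (2 * m)).IsContained G := by
  -- A zigzag with both ends in `B` has an odd number 2j + 1 of vertices, which is why the remaining
  -- length must be odd. The slack 4M + 10 gives j ≤ 2M + 4, within the sizes of `A` and `B`.
  obtain ⟨j, hj⟩ : ∃ j, P.length + (Z.L h₀).length + (Z.L h₁).length + (2 * j + 1) = 2 * m :=
    ⟨(2 * m - (P.length + (Z.L h₀).length + (Z.L h₁).length)) / 2, by omega⟩
  have hcB := Z.card_B
  have hcA := Z.card_A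
  -- `b₀` is withheld from the zigzag, since `P` may already pass through it.
  have hB' : Z.B.card - 1 ≤ (Z.B.erase b₀).card := Finset.pred_card_le_card_erase
  obtain ⟨l, b, hb, b', hb', hl, hlen, hmem⟩ := exists_zigzag (G := G) (j := j) (A := Z.A)
    (B := Z.B.erase b₀) (Z.disjoint_AB.mono_right (Finset.erase_subset _ _))
    (fun x hx y hy => Z.adj x hx y (Finset.mem_of_mem_erase hy)) (by omega) (by omega)
  have hmem' : ∀ x ∈ l, x ∈ Z.A ∨ x ∈ Z.B := fun x hx =>
    (hmem x hx).imp_right Finset.mem_of_mem_erase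
  have hLl : ∀ h ∈ Z.H, ∀ x ∈ Z.L h, x ∉ l := fun h hh x hx hxl =>
    (hmem' x hxl).elim (Z.notMem_A h hh x hx) (Z.notMem_B h hh x hx)
  have hPl : ∀ x ∈ P, x ∉ l := fun x hx hxl => by
    rcases hmem x hxl with h | h
    · exact hPA x hx h
    · exact Finset.ne_of_mem_erase h (hPB x hx (Finset.mem_of_mem_erase h))
  have e1 := hl.append (Z.isListPath h₀ hh₀).reverse
    (Z.adj_terminal h₀ hh₀ b' (Finset.mem_of_mem_erase hb')).symm
    (fun x hx hx' => hLl h₀ hh₀ x (List.mem_reverse.1 hx') hx)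
  have e2 := (Z.isListPath h₁ hh₁).append e1
    (Z.adj_terminal h₁ hh₁ b (Finset.mem_of_mem_erase hb)) (fun x hx hx' => by
      rcases List.mem_append.1 hx' with h | h
      · exact hLl h₁ hh₁ x hx h
      · exact Z.disjoint h₁ hh₁ h₀ hh₀ hne.symm x hx (List.mem_reverse.1 h))
  have e3 := hP.append e2 hv (fun x hx hx' => by
      rcases List.mem_append.1 hx' with h | h
      · exact hPL₁ x hx h
      rcases List.mem_append.1 h with h | h
      · exact hPl x hx h
      · exact hPL₀ x hx (List.mem_reverse.1 h))
  have e4 := e3.cycleGraph_isContained hu.symm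
  convert e4 using 2 <;> simp [hlen] <;> omega

/-- A path outside the hub, all of whose vertices have at least seven neighbours among the entry
vertices, can be completed to an even cycle of prescribed length, slightly longer than the path. -/
lemma exists_cycle [DecidableEq V] [Fintype V] [DecidableRel G.Adj] (Z : Hub G M) {m : ℕ}
    (hm : 2 * M + 6 ≤ m) {P : List V} (hn : P.Nodup) (hc : P.IsChain G.Adj)
    (hlen : P.length + (4 * M + 10) = 2 * m) (hP : ∀ x ∈ P, Z.Avoids x)
    (hdeg : ∀ x ∈ P, 7 ≤ (G.neighborFinset x ∩ Z.H).card) :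
    (cycleGraph (2 * m)).IsContained G := by
  set C : V → ℕ → Finset V :=
    fun x t => (G.neighborFinset x ∩ Z.H).filter fun h => (Z.L h).length % 2 = t with hC
  -- Of seven entry vertices, four have hub paths of the same length parity. Four are enough to
  -- avoid the at most three entries used elsewhere.
  have hτ : ∀ x ∈ P, ∃ t, t < 2 ∧ 4 ≤ (C x t).card := by
    intro x hx
    have h1 := hdeg x hx
    have h2 := Finset.card_filter_add_card_filter_not (s := G.neighborFinset x ∩ Z.H)
      (fun h => (Z.L h).length % 2 = 0)
    by_cases h3 : 4 ≤ (C x 0).card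
    · exact ⟨0, by omega, h3⟩
    · refine ⟨1, by omega, ?_⟩
      have h4 : (C x 1) = (G.neighborFinset x ∩ Z.H).filter fun h => ¬ (Z.L h).length % 2 = 0 := by
        refine Finset.filter_congr fun h _ => ?_
        omega
      rw [h4]
      simp only [hC] at h3
      omega
  choose! τ hτ2 hτ4 using hτ
  have hCmem : ∀ x t h, h ∈ C x t → h ∈ Z.H ∧ G.Adj x h ∧ (Z.L h).length % 2 = t := by
    intro x t h hh
    simp only [hC, Finset.mem_filter, Finset.mem_inter, mem_neighborFinset] at hh
    tauto
  have pick : ∀ x ∈ P, ∀ S : Finset V, S.card < 4 → ∃ h ∈ Z.H, h ∉ S ∧ G.Adj x h ∧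
      (Z.L h).length % 2 = τ x := by
    intro x hx S hS
    obtain ⟨h, hh, hhS⟩ := Finset.exists_mem_notMem_of_card_lt_card (hS.trans_le (hτ4 x hx))
    obtain ⟨h1, h2, h3⟩ := hCmem _ _ _ hh
    exact ⟨h, h1, hhS, h2, h3⟩
  have hpos : 0 < P.length := by omega
  have hPb : ∀ {b₀ : V}, ∀ x ∈ P, x ∈ Z.B → x = b₀ := fun x hx h => absurd h (hP x hx).2.2
  obtain ⟨b₀, hb₀⟩ := Finset.card_pos.1 (show 0 < Z.B.card by have := Z.card_B; omega)
  obtain ⟨h₀, hh₀, -, ha₀, hp₀⟩ := pick P[0] (List.getElem_mem _) ∅ (by simp)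
  obtain ⟨h₁, hh₁, hS₁, ha₁, hp₁⟩ := pick P[P.length - 1] (List.getElem_mem _) {h₀} (by simp)
  have hl₀ := Z.length_le h₀ hh₀
  have hl₁ := Z.length_le h₁ hh₁
  by_cases hcase : (τ P[0] + τ P[P.length - 1] + P.length) % 2 = 1
  · refine Z.close (b₀ := b₀) ⟨hn, hc, ?_, ?_⟩ hh₀ hh₁ (by rintro rfl; simp at hS₁) ha₀ ha₁
      (fun x hx => (hP x hx).1 h₀ hh₀) (fun x hx => (hP x hx).1 h₁ hh₁) (fun x hx => (hP x hx).2.1)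
      hPb (by omega) (by omega) (by omega)
    · rw [List.head?_eq_getElem?, List.getElem?_eq_getElem]
    · rw [List.getLast?_eq_getElem?, List.getElem?_eq_getElem]
  -- If `τ` alternated all along `P`, the ends would already have the right parity. At two
  -- consecutive vertices with equal `τ`, their edge is replaced by a detour through two hub paths
  -- and `b₀`, which adds an odd number of vertices.
  · have hflip : ∃ p, ∃ h : p + 1 < P.length, (τ P[p] + τ P[p + 1]) % 2 = 0 := by
      by_contra! hcon
      have : ∀ i (hi : i < P.length), (τ P[0] + τ P[i] + i) % 2 = 0 := by
        intro i
        induction i with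
        | zero => intro hi; omega
        | succ i ih =>
          intro hi
          have h1 := ih (by omega)
          have h2 := hcon i hi
          omega
      have := this (P.length - 1) (by omega)
      omega
    obtain ⟨p, hp, hpar⟩ := hflip
    obtain ⟨h₂, hh₂, hS₂, ha₂, hp₂⟩ := pick P[p] (List.getElem_mem _) {h₀, h₁}
      (Finset.card_le_two.trans_lt (by omega))
    obtain ⟨h₃, hh₃, hS₃, ha₃, hp₃⟩ := pick P[p + 1] (List.getElem_mem _) {h₀, h₁, h₂}
      (Finset.card_le_three.trans_lt (by omega))
    simp only [Finset.mem_insert, Finset.mem_singleton, not_or] at hS₁ hS₂ hS₃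
    have hl₂ := Z.length_le h₂ hh₂
    have hl₃ := Z.length_le h₃ hh₃
    have hT : ∀ x ∈ P.take (p + 1), x ∈ P := fun x hx => List.mem_of_mem_take hx
    have hD : ∀ x ∈ P.drop (p + 1), x ∈ P := fun x hx => List.mem_of_mem_drop hx
    have e1 := (Z.isListPath h₃ hh₃).reverse.append (isListPath_drop hn hc hp) ha₃.symm
      (fun x hx hx' => (hP x (hD x hx')).1 h₃ hh₃ (List.mem_reverse.1 hx))
    have e2 := (IsListPath.singleton b₀).append e1 (Z.adj_terminal h₃ hh₃ b₀ hb₀).symm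
      (fun x hx hx' => by
        rw [List.mem_singleton] at hx
        subst hx
        rcases List.mem_append.1 hx' with h | h
        · exact Z.notMem_B h₃ hh₃ x (List.mem_reverse.1 h) hb₀
        · exact (hP x (hD x h)).2.2 hb₀)
    have e3 := (Z.isListPath h₂ hh₂).append e2 (Z.adj_terminal h₂ hh₂ b₀ hb₀)
      (fun x hx hx' => by
        rcases List.mem_append.1 hx' with h | h
        · rw [List.mem_singleton] at h
          subst h
          exact Z.notMem_B h₂ hh₂ x hx hb₀
        rcases List.mem_append.1 h with h | h
        · exact Z.disjoint h₂ hh₂ h₃ hh₃ (Ne.symm hS₃.2.2) x hx (List.mem_reverse.1 h)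
        · exact (hP x (hD x h)).1 h₂ hh₂ hx)
    have e4 := (isListPath_take hn hc (show p < P.length by omega)).append e3 ha₂
      (fun x hx hx' => by
        have hxP := hT x hx
        rcases List.mem_append.1 hx' with h | h
        · exact (hP x hxP).1 h₂ hh₂ h
        rcases List.mem_append.1 h with h | h
        · rw [List.mem_singleton] at h
          subst h
          exact (hP x hxP).2.2 hb₀
        rcases List.mem_append.1 h with h | h
        · exact (hP x hxP).1 h₃ hh₃ (List.mem_reverse.1 h)
        · rw [← List.take_append_drop (p + 1) P, List.nodup_append] at hn
          exact hn.2.2 x hx x h rfl)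
    have hmem : ∀ x ∈ P.take (p + 1) ++ (Z.L h₂ ++ ([b₀] ++ ((Z.L h₃).reverse ++ P.drop (p + 1)))),
        x ∈ P ∨ x ∈ Z.L h₂ ∨ x = b₀ ∨ x ∈ Z.L h₃ := by
      intro x hx
      simp only [List.mem_append, List.mem_singleton, List.mem_reverse] at hx
      rcases hx with h | h | h | h | h
      · exact Or.inl (hT x h)
      · exact Or.inr (Or.inl h)
      · exact Or.inr (Or.inr (Or.inl h))
      · exact Or.inr (Or.inr (Or.inr h))
      · exact Or.inl (hD x h)
    have hlen' : (P.take (p + 1) ++ (Z.L h₂ ++ ([b₀] ++ ((Z.L h₃).reverse ++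
        P.drop (p + 1))))).length = P.length + (Z.L h₂).length + (Z.L h₃).length + 1 := by
      simp
      omega
    have hdisj : ∀ h ∈ Z.H, h ≠ h₂ → h ≠ h₃ → ∀ x ∈ P.take (p + 1) ++ (Z.L h₂ ++ ([b₀] ++
        ((Z.L h₃).reverse ++ P.drop (p + 1)))), x ∉ Z.L h := by
      intro h hh hne₂ hne₃ x hx hxL
      rcases hmem x hx with h' | h' | h' | h'
      · exact (hP x h').1 h hh hxL
      · exact Z.disjoint h hh h₂ hh₂ hne₂ x hxL h'
      · exact Z.notMem_B h hh x hxL (h' ▸ hb₀)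
      · exact Z.disjoint h hh h₃ hh₃ hne₃ x hxL h'
    refine Z.close (b₀ := b₀) e4 hh₀ hh₁ (Ne.symm hS₁) ha₀ ha₁
      (hdisj h₀ hh₀ (Ne.symm hS₂.1) (Ne.symm hS₃.1))
      (hdisj h₁ hh₁ (Ne.symm hS₂.2) (Ne.symm hS₃.2.1)) ?_ ?_ ?_ ?_ ?_
    · intro x hx hxA
      rcases hmem x hx with h' | h' | h' | h'
      · exact (hP x h').2.1 hxA
      · exact Z.notMem_A h₂ hh₂ x h' hxA
      · exact Finset.disjoint_left.1 Z.disjoint_AB hxA (h' ▸ hb₀)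
      · exact Z.notMem_A h₃ hh₃ x h' hxA
    · intro x hx hxB
      rcases hmem x hx with h' | h' | h' | h'
      · exact absurd hxB (hP x h').2.2
      · exact absurd hxB (Z.notMem_B h₂ hh₂ x h')
      · exact h'
      · exact absurd hxB (Z.notMem_B h₃ hh₃ x h')
    · rw [hlen']; omega
    · rw [hlen']; omega
    · rw [hlen']; omega

end Hub

lemma _root_.Finset.exists_injOn_of_card_eq {α : Type*} {s t : Finset α} (h : s.card = t.card) :
    ∃ f : α → α, (∀ x ∈ s, f x ∈ t) ∧ ∀ x ∈ s, ∀ y ∈ s, f x = f y → x = y := by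
  classical
  let e := Finset.equivOfCardEq h
  refine ⟨fun x => if hx : x ∈ s then e ⟨x, hx⟩ else x, ?_, ?_⟩
  · intro x hx
    simp [hx]
  · intro x hx y hy hxy
    simp only [hx, hy, dif_pos] at hxy
    simpa using e.injective (Subtype.ext hxy)

/-- A dense, robustly connected graph has a hub of bounded size such that almost all vertices have
at least seven neighbours among its entry vertices. -/
lemma IsRobust.exists_hub [Fintype V] [Nonempty V] [DecidableEq V] [DecidableRel G.Adj]
    {k Q M s : ℕ} (hG : G.IsRobust k) (hM : M = 3 * Q + 1) (hs : s = 28 * Q ^ 2 + 2 * M + 8)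
    (hQ : 0 < Q) (hk₀ : 12 ≤ k) (hk₁ : 8 * Q * s ≤ k)
    (hk₂ : 4 * ((4 * Q * s).choose s * s) < k)
    (hk₃ : 2 * (28 * Q ^ 2 + 2 * s + 28 * Q ^ 2 * M) ≤ k) (hV : Fintype.card V ≤ Q * k)
    (hδ : ∀ v, 2 * k ≤ G.degree v) :
    ∃ (Z : Hub G M) (S : Finset V), S.card ≤ k ∧ (∀ x ∉ S, Z.Avoids x) ∧
      ∀ x ∉ S, 7 ≤ (G.neighborFinset x ∩ Z.H).card := by
  obtain ⟨H, hH, hbad⟩ := exists_dominating (G := G) hQ hk₀ hV fun v => (by have := hδ v; omega)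
  have hs0 : 0 < s := by omega
  obtain ⟨A, B, hAH, hBH, hAB, hA, hB, hadj⟩ :=
    exists_completeBipartite hQ hs0 hk₁ hk₂ hV hδ H (by omega)
  -- `T` is reserved for the terminals; the choice of s leaves at least 2M + 8 vertices of `A` for
  -- the zigzags.
  obtain ⟨T, hTA, hT⟩ := Finset.exists_subset_card_eq (show H.card ≤ A.card by omega)
  obtain ⟨a, haT, hainj⟩ := Finset.exists_injOn_of_card_eq hT.symm
  set F := H ∪ (A ∪ B) with hF
  have hFcard : F.card ≤ 28 * Q ^ 2 + 2 * s := by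
    have h1 := Finset.card_union_le H (A ∪ B)
    have h2 := Finset.card_union_le A B
    rw [hF]
    omega
  have hHM : H.card * M ≤ 28 * Q ^ 2 * M := Nat.mul_le_mul_right _ hH
  have hanH : ∀ h ∈ H, a h ∉ H := fun h hh =>
    Finset.disjoint_left.1 hAH (hTA (haT h hh))
  obtain ⟨L, hL, hLd⟩ := (hG.isLinked (by omega) hV hδ).exists_linkage (H := H) (F := F) (a := a)
    Finset.subset_union_left
    (fun h hh => Finset.mem_union_right _ (Finset.mem_union_left _ (hTA (haT h hh)))) hainj
    hanH (by subst hM; omega)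
  refine ⟨{ H := H, a := a, L := L, A := A \ T, B := B,
            isListPath := fun h hh => (hL h hh).1
            length_le := fun h hh => by subst hM; exact (hL h hh).2.1
            disjoint := hLd
            notMem_A := ?_
            notMem_B := ?_
            adj_terminal := fun h hh b hb => hadj _ (hTA (haT h hh)) b hb
            adj := fun x hx b hb => hadj x (Finset.sdiff_subset hx) b hb
            disjoint_AB := hAB.mono_left Finset.sdiff_subset
            card_A := ?_
            card_B := by omega },
          (F ∪ H.biUnion fun h => (L h).toFinset) ∪
            Finset.univ.filter fun v => (G.neighborFinset v ∩ H).card < 7, ?_, ?_, ?_⟩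
  · intro h hh x hx hxA
    have hxA' := Finset.mem_sdiff.1 hxA
    rcases (hL h hh).2.2 x hx (Finset.mem_union_right _ (Finset.mem_union_left _ hxA'.1)) with
      rfl | rfl
    · exact Finset.disjoint_left.1 hAH hxA'.1 hh
    · exact hxA'.2 (haT h hh)
  · intro h hh x hx hxB
    rcases (hL h hh).2.2 x hx (Finset.mem_union_right _ (Finset.mem_union_right _ hxB)) with
      rfl | rfl
    · exact Finset.disjoint_left.1 hBH hxB hh
    · exact Finset.disjoint_left.1 hAB (hTA (haT h hh)) hxB
  · rw [Finset.card_sdiff_of_subset hTA]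
    omega
  · have h1 : (H.biUnion fun h => (L h).toFinset).card ≤ H.card * M :=
      Finset.card_biUnion_le_card_mul _ _ _ fun h hh =>
        (List.toFinset_card_le _).trans (by subst hM; exact (hL h hh).2.1)
    have h2 := Finset.card_union_le F (H.biUnion fun h => (L h).toFinset)
    have h3 := Finset.card_union_le (F ∪ H.biUnion fun h => (L h).toFinset)
      (Finset.univ.filter fun v => (G.neighborFinset v ∩ H).card < 7)
    omega
  · intro x hx
    simp only [Finset.mem_union, Finset.mem_biUnion, List.mem_toFinset, not_or, not_exists,
      not_and, hF] at hx
    exact ⟨hx.1.2, fun h => hx.1.1.2.1 (Finset.sdiff_subset h), hx.1.1.2.2⟩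
  · intro x hx
    simp only [Finset.mem_union, Finset.mem_filter, Finset.mem_univ, true_and, not_or, not_lt] at hx
    exact hx.2

/-- A robustly connected graph of minimum degree slightly above `m` and order slightly above `2m`
contains a cycle of length `2m`. -/
theorem exists_even_cycle (Q : ℕ) : ∃ k₀, ∀ k, k₀ ≤ k → ∀ {V : Type} [Fintype V]
    (G : SimpleGraph V) [DecidableRel G.Adj] (m : ℕ), k ≤ m → Fintype.card V ≤ Q * k →
    2 * m + 2 * k ≤ Fintype.card V → (∀ v, m + 2 * k ≤ G.degree v) → G.IsRobust k →
    (cycleGraph (2 * m)).IsContained G := by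
  classical
  obtain ⟨M, hM⟩ : ∃ M, M = 3 * Q + 1 := ⟨_, rfl⟩
  obtain ⟨s, hs⟩ : ∃ s, s = 28 * Q ^ 2 + 2 * M + 8 := ⟨_, rfl⟩
  refine ⟨12 + 8 * Q * s + (4 * ((4 * Q * s).choose s * s) + 1) +
    2 * (28 * Q ^ 2 + 2 * s + 28 * Q ^ 2 * M), ?_⟩
  intro k hk V _ G _ m hkm hV hV' hδ hG
  have hQ : 0 < Q := by
    rcases Nat.eq_zero_or_pos Q with rfl | h
    · omega
    · exact h
  have : Nonempty V := Fintype.card_pos_iff.1 (by omega)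
  obtain ⟨Z, S, hS, hav, hdeg⟩ := hG.exists_hub hM hs hQ (by omega) (by omega) (by omega)
    (by omega) hV fun v => (by have := hδ v; omega)
  have hcard : Fintype.card {x | x ∉ S} = Fintype.card V - S.card := by
    rw [← Finset.card_compl, ← Fintype.card_coe]
    exact Fintype.card_congr (Equiv.subtypeEquivRight fun x => by simp)
  -- Removing `S` costs at most k in degree and in order, so a path of this length survives outside
  -- it; the hub supplies the missing 4M + 10 vertices.
  obtain ⟨l, hn, hc, hlen⟩ := exists_path_of_minDegree (hG S hS) (δ := m) (fun w => by
    have h1 := degree_le_degree_induce_add_card (G := G) S w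
    have h2 := hδ w
    omega) (by omega) (q := 2 * m - (4 * M + 10)) (by omega)
  have hmem : ∀ x ∈ l.map Subtype.val, x ∉ S := by
    intro x hx
    obtain ⟨y, -, rfl⟩ := List.mem_map.1 hx
    exact y.2
  refine Z.exists_cycle (m := m) (by omega) (P := l.map Subtype.val)
    (hn.map Subtype.val_injective) ?_ (by rw [List.length_map, hlen]; omega)
    (fun x hx => hav x (hmem x hx)) (fun x hx => hdeg x (hmem x hx))
  rw [List.isChain_map]
  exact hc.imp fun _ _ h => h

/-! ### Matchings and fans -/

/-- The pairs `g (i, false)`, `g (i, true)` are disjoint edges of `G` inside `Y`. -/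
def IsMatchingOn (G : SimpleGraph V) (Y : Finset V) {k : ℕ} (g : Fin k × Bool → V) : Prop :=
  Function.Injective g ∧ (∀ p, g p ∈ Y) ∧ ∀ i, G.Adj (g (i, false)) (g (i, true))

lemma IsMatchingOn.extend {Y : Finset V} {k : ℕ} {g : Fin k × Bool → V}
    (hg : G.IsMatchingOn Y g) {x y : V} (hx : x ∈ Y) (hy : y ∈ Y) (hxg : ∀ p, g p ≠ x)
    (hyg : ∀ p, g p ≠ y) (hadj : G.Adj x y) :
    ∃ g' : Fin (k + 1) × Bool → V, G.IsMatchingOn Y g' := by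
  have hxy := hadj.ne
  obtain ⟨h1, h2, h3⟩ := hg
  refine ⟨fun p => Fin.cases (motive := fun _ => V) (if p.2 then y else x)
    (fun i => g (i, p.2)) p.1, ?_, ?_, ?_⟩
  · rintro ⟨i, b⟩ ⟨j, c⟩ h
    induction i using Fin.cases with
    | zero =>
      induction j using Fin.cases with
      | zero => cases b <;> cases c <;> simp_all
      | succ j =>
        cases b
        · exact absurd h.symm (hxg (j, c))
        · exact absurd h.symm (hyg (j, c))
    | succ i =>
      induction j using Fin.cases with
      | zero =>
        cases c
        · exact absurd h (hxg (i, b))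
        · exact absurd h (hyg (i, b))
      | succ j =>
        have := h1 (a₁ := (i, b)) (a₂ := (j, c)) h
        simp_all
  · rintro ⟨i, b⟩
    induction i using Fin.cases with
    | zero => cases b <;> simp [hx, hy]
    | succ i => exact h2 (i, b)
  · intro i
    induction i using Fin.cases with
    | zero => simpa using hadj
    | succ i => exact h3 i

/-- An augmenting path of length three enlarges a matching. -/
lemma IsMatchingOn.augment {Y : Finset V} {k : ℕ} {g : Fin k × Bool → V}
    (hg : G.IsMatchingOn Y g) (i : Fin k) {x y : V} (hx : x ∈ Y) (hy : y ∈ Y)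
    (hxg : ∀ p, g p ≠ x) (hyg : ∀ p, g p ≠ y) (hxy : x ≠ y) (hfx : G.Adj (g (i, false)) x)
    (hty : G.Adj (g (i, true)) y) :
    ∃ g' : Fin (k + 1) × Bool → V, G.IsMatchingOn Y g' := by
  classical
  obtain ⟨h1, h2, h3⟩ := hg
  have hg' : G.IsMatchingOn Y (Function.update g (i, true) x) := by
    refine ⟨?_, ?_, ?_⟩
    · intro p q hpq
      by_cases hp : p = (i, true) <;> by_cases hq : q = (i, true)
      · rw [hp, hq]
      · rw [hp, Function.update_self, Function.update_of_ne hq] at hpq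
        exact absurd hpq.symm (hxg q)
      · rw [hq, Function.update_self, Function.update_of_ne hp] at hpq
        exact absurd hpq (hxg p)
      · rw [Function.update_of_ne hp, Function.update_of_ne hq] at hpq
        exact h1 hpq
    · intro p
      by_cases hp : p = (i, true)
      · rw [hp, Function.update_self]
        exact hx
      · rw [Function.update_of_ne hp]
        exact h2 p
    · intro j
      rw [Function.update_of_ne (by simp)]
      by_cases hj : j = i
      · rw [hj, Function.update_self]
        exact hfx
      · rw [Function.update_of_ne (by simp [hj])]
        exact h3 j
  refine hg'.extend (h2 (i, true)) hy ?_ ?_ hty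
  · intro p
    by_cases hp : p = (i, true)
    · rw [hp, Function.update_self]
      exact (hxg _).symm
    · rw [Function.update_of_ne hp]
      exact fun h => hp (h1 h)
  · intro p
    by_cases hp : p = (i, true)
    · rw [hp, Function.update_self]
      exact hxy
    · rw [Function.update_of_ne hp]
      exact hyg p

/-- A vertex set without a matching of size `n` consists of an independent set `U`, a set `W` of
fewer than `n` vertices with at most one neighbour in `U` each, and `|W|` further vertices. -/
lemma exists_independent_of_no_matching [DecidableEq V] [DecidableRel G.Adj] {Y : Finset V} {n : ℕ}
    (hY : ¬ ∃ g : Fin n × Bool → V, G.IsMatchingOn Y g) :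
    ∃ U W : Finset V, U ⊆ Y ∧ W ⊆ Y ∧ Disjoint U W ∧ U.card + 2 * W.card = Y.card ∧ W.card < n ∧
      (∀ x ∈ U, ∀ y ∈ U, ¬ G.Adj x y) ∧ ∀ w ∈ W, (U.filter fun u => G.Adj w u).card ≤ 1 := by
  -- `U` will be the set of vertices missed by a maximum matching. `W` takes from each matching edge
  -- an end with at most one neighbour in `U`: otherwise distinct neighbours of the two ends give an
  -- augmenting path.
  obtain ⟨k, hkn, ⟨g, hg⟩, hk⟩ : ∃ k < n, (∃ g : Fin k × Bool → V, G.IsMatchingOn Y g) ∧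
      ¬ ∃ g : Fin (k + 1) × Bool → V, G.IsMatchingOn Y g := by
    by_contra! hcon
    have : ∀ k ≤ n, ∃ g : Fin k × Bool → V, G.IsMatchingOn Y g := by
      intro k
      induction k with
      | zero =>
        exact fun _ => ⟨fun p => p.1.elim0, fun p => p.1.elim0, fun p => p.1.elim0,
          fun i => i.elim0⟩
      | succ k ih => exact fun hk => hcon k (by omega) (ih (by omega))
    exact hY (this n le_rfl)
  set U := Y \ Finset.univ.image g with hU
  have hUY : ∀ x ∈ U, x ∈ Y := fun x hx => (Finset.mem_sdiff.1 hx).1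
  have hUg : ∀ x ∈ U, ∀ p, g p ≠ x := fun x hx p h =>
    (Finset.mem_sdiff.1 hx).2 (Finset.mem_image.2 ⟨p, Finset.mem_univ _, h⟩)
  have hβ : ∀ i, ∃ b, (U.filter fun u => G.Adj (g (i, b)) u).card ≤ 1 := by
    intro i
    by_contra! hcon
    obtain ⟨x, hx⟩ := Finset.card_pos.1 (zero_lt_one.trans (hcon false))
    obtain ⟨y, hy, hyx⟩ := Finset.exists_mem_ne (hcon true) x
    rw [Finset.mem_filter] at hx hy
    exact hk (hg.augment i (hUY x hx.1) (hUY y hy.1) (hUg x hx.1) (hUg y hy.1) hyx.symm hx.2 hy.2)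
  choose β hβ using hβ
  have hW : (Finset.univ.image fun i => g (i, β i)).card = k := by
    rw [Finset.card_image_of_injective, Finset.card_univ, Fintype.card_fin]
    intro i j hij
    exact (Prod.ext_iff.1 (hg.1 hij)).1
  refine ⟨U, Finset.univ.image fun i => g (i, β i), hUY, ?_, ?_, ?_, by omega, ?_, ?_⟩
  · intro x hx
    obtain ⟨i, -, rfl⟩ := Finset.mem_image.1 hx
    exact hg.2.1 _
  · refine Finset.disjoint_left.2 fun x hx hx' => ?_
    obtain ⟨i, -, rfl⟩ := Finset.mem_image.1 hx'
    exact hUg _ hx _ rfl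
  · have himg : (Finset.univ.image g).card = 2 * k := by
      rw [Finset.card_image_of_injective _ hg.1, Finset.card_univ, Fintype.card_prod,
        Fintype.card_fin, Fintype.card_bool, mul_comm]
    have hsub : Finset.univ.image g ⊆ Y := by
      intro x hx
      obtain ⟨p, -, rfl⟩ := Finset.mem_image.1 hx
      exact hg.2.1 p
    have h1 := Finset.card_sdiff_add_card_eq_card hsub
    rw [hW, ← himg]
    exact h1
  · intro x hx y hy hadj
    exact hk (hg.extend (hUY x hx) (hUY y hy) (hUg x hx) (hUg y hy) hadj)
  · intro w hw
    obtain ⟨i, -, rfl⟩ := Finset.mem_image.1 hw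
    exact hβ i

/-- A vertex joined to all vertices of a matching of size `n` spans a fan with it. -/
lemma IsMatchingOn.fanGraph_isContained {Y : Finset V} {n : ℕ} {g : Fin n × Bool → V}
    (hg : G.IsMatchingOn Y g) {v : V} (hv : ∀ y ∈ Y, G.Adj v y) : (fanGraph n).IsContained G := by
  refine ⟨⟨⟨fun o => o.elim v g, ?_⟩, ?_⟩⟩
  · rintro (_ | ⟨i, b⟩) (_ | ⟨j, c⟩) h
    · exact h.elim
    · exact hv _ (hg.2.1 _)
    · exact (hv _ (hg.2.1 _)).symm
    · obtain ⟨h1, h2⟩ := h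
      simp only at h1 h2
      subst h1
      cases b <;> cases c
      · exact absurd rfl h2
      · exact hg.2.2 i
      · exact (hg.2.2 i).symm
      · exact absurd rfl h2
  · rintro (_ | p) (_ | q) h
    · rfl
    · exact absurd h (hv _ (hg.2.1 q)).ne
    · exact absurd h.symm (hv _ (hg.2.1 p)).ne
    · exact congrArg some (hg.1 h)

lemma card_le_degree_induce [Fintype V] {s : Set V} [Fintype s]
    [DecidableRel (G.induce s).Adj] (v : s) (T : Finset V) (hT : ∀ t ∈ T, t ∈ s ∧ G.Adj v t) :
    T.card ≤ (G.induce s).degree v := by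
  classical
  rw [← card_neighborFinset_eq_degree]
  refine (Finset.card_le_card (t := ((G.induce s).neighborFinset v).image Subtype.val) ?_).trans
    Finset.card_image_le
  intro t ht
  exact Finset.mem_image.2 ⟨⟨t, (hT t ht).1⟩, by rw [mem_neighborFinset]; exact (hT t ht).2, rfl⟩

/-! ### Robust cliques and splittings into robust classes -/

/-- A large clique `U` with further vertices joined to all but at most one vertex of `U` is
robustly connected. -/
lemma isRobust_induce_of_clique [DecidableEq V] {U W : Finset V} {k : ℕ} (hUk : k + 2 ≤ U.card)
    (hU : ∀ x ∈ U, ∀ y ∈ U, x ≠ y → G.Adj x y)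
    (hW : ∀ w ∈ W, ∀ T ⊆ U, 2 ≤ T.card → ∃ u ∈ T, G.Adj w u) :
    (G.induce {x | x ∈ U ∪ W}).IsRobust k := by
  intro S hS
  set T := U \ S.image Subtype.val with hT
  -- At least two vertices of `U` survive, as many as are needed to guarantee a neighbour for every
  -- vertex of `W`.
  have hTcard : 2 ≤ T.card := by
    have h1 := Finset.le_card_sdiff (S.image Subtype.val) U
    have h2 := Finset.card_image_le (s := S) (f := Subtype.val)
    rw [hT]
    omega
  have hTm : ∀ x ∈ T, ∃ h : x ∈ U ∪ W, (⟨x, h⟩ : {x | x ∈ U ∪ W}) ∉ S := by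
    intro x hx
    obtain ⟨h1, h2⟩ := Finset.mem_sdiff.1 hx
    exact ⟨Finset.mem_union_left _ h1, fun h => h2 (Finset.mem_image.2 ⟨_, h, rfl⟩)⟩
  obtain ⟨u₀, hu₀⟩ := Finset.card_pos.1 (show 0 < T.card by omega)
  obtain ⟨hm₀, hS₀⟩ := hTm u₀ hu₀
  have hTU : ∀ x ∈ T, x ∈ U := fun x hx => (Finset.mem_sdiff.1 hx).1
  have hclique : ∀ (x : {y : {x | x ∈ U ∪ W} | y ∉ S}), x.1.1 ∈ U →
      ((G.induce {x | x ∈ U ∪ W}).induce {y | y ∉ S}).Reachable x ⟨⟨u₀, hm₀⟩, hS₀⟩ := by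
    intro x hx
    by_cases h : x.1.1 = u₀
    · have : x = ⟨⟨u₀, hm₀⟩, hS₀⟩ := Subtype.ext (Subtype.ext h)
      rw [this]
    · exact Adj.reachable (hU _ hx _ (hTU _ hu₀) h)
  have hall : ∀ x, ((G.induce {x | x ∈ U ∪ W}).induce {y | y ∉ S}).Reachable x
      ⟨⟨u₀, hm₀⟩, hS₀⟩ := by
    intro x
    rcases Finset.mem_union.1 x.1.2 with hx | hx
    · exact hclique x hx
    · obtain ⟨u, hu, hadj⟩ := hW _ hx T (fun y hy => hTU y hy) hTcard
      obtain ⟨hm, hmS⟩ := hTm u hu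
      refine Reachable.trans (v := ⟨⟨u, hm⟩, hmS⟩) ?_ (hclique _ (hTU u hu))
      exact Adj.reachable hadj
  exact fun x y => (hall x).trans (hall y).symm

/-- The function `f` splits the vertices of `G` into a set `f = 0` of at most `(p - 1) k` vertices
and `p` nonempty classes with values `1, …, p`, such that no edge joins distinct classes. -/
def IsSplitting [Fintype V] (G : SimpleGraph V) (k p : ℕ) (f : V → ℕ) : Prop :=
  (∀ v, f v ≤ p) ∧ (∀ i, 1 ≤ i → i ≤ p → ∃ v, f v = i) ∧
    (Finset.univ.filter fun v => f v = 0).card ≤ (p - 1) * k ∧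
    ∀ u v, G.Adj u v → f u ≠ 0 → f v ≠ 0 → f u = f v

/-- A set `S` of at most k vertices disconnects class i. It is moved to class 0, one component of
the rest becomes class p + 1, and the remaining vertices keep the value i. -/
lemma IsSplitting.refine [Fintype V] {k p i : ℕ} {f : V → ℕ} (hf : G.IsSplitting k p f)
    (hi : 1 ≤ i) (hip : i ≤ p) (hnr : ¬ (G.induce {x | f x = i}).IsRobust k) :
    ∃ f', G.IsSplitting k (p + 1) f' := by
  classical
  obtain ⟨h1, h2, h3, h4⟩ := hf
  unfold IsRobust at hnr
  push Not at hnr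
  obtain ⟨S, hS, hpre⟩ := hnr
  unfold Preconnected at hpre
  push Not at hpre
  obtain ⟨a, b, hab⟩ := hpre
  set Γ := (G.induce {x | f x = i}).induce {x | x ∉ S} with hΓ
  set R : V → Prop := fun x => ∃ (h : f x = i) (h' : (⟨x, h⟩ : {x | f x = i}) ∉ S),
    Γ.Reachable a ⟨⟨x, h⟩, h'⟩ with hR
  set S' := S.image Subtype.val with hS'
  have hS'm : ∀ x (h : f x = i), x ∉ S' → (⟨x, h⟩ : {x | f x = i}) ∉ S := fun x h hx hxS =>
    hx (Finset.mem_image.2 ⟨_, hxS, rfl⟩)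
  have hS'f : ∀ x ∈ S', f x = i := by
    intro x hx
    obtain ⟨y, -, rfl⟩ := Finset.mem_image.1 hx
    exact y.2
  have hRS' : ∀ x, R x → x ∉ S' := by
    rintro x ⟨h, h', -⟩ hx
    obtain ⟨y, hy, rfl⟩ := Finset.mem_image.1 hx
    exact h' hy
  have hnot : ∀ z : {x : {x | f x = i} | x ∉ S}, z.1.1 ∉ S' := by
    intro z hz
    obtain ⟨y, hy, hyz⟩ := Finset.mem_image.1 hz
    exact z.2 ((Subtype.ext hyz : y = z.1) ▸ hy)
  have hcross : ∀ u v, G.Adj u v → R u → v ∉ S' → f v = i → R v := by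
    rintro u v hadj ⟨hu, hu', hr⟩ hv hvi
    exact ⟨hvi, hS'm v hvi hv, hr.trans (Adj.reachable hadj)⟩
  refine ⟨fun x => if x ∈ S' then 0 else if R x then p + 1 else f x, ?_, ?_, ?_, ?_⟩
  · intro v
    have := h1 v
    dsimp only
    split_ifs <;> omega
  · intro j hj hjp
    rcases Nat.lt_or_ge p j with hpj | hpj
    · refine ⟨a.1.1, ?_⟩
      have hRa : R a.1.1 := ⟨a.1.2, a.2, Reachable.refl _⟩
      simp only [hnot a, hRa, if_true, if_false]
      omega
    · by_cases hji : j = i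
      · refine ⟨b.1.1, ?_⟩
        have hRb : ¬ R b.1.1 := by
          rintro ⟨h, h', hr⟩
          exact hab hr
        simp only [hnot b, hRb, if_false]
        rw [hji]
        exact b.1.2
      · obtain ⟨v, hv⟩ := h2 j hj hpj
        refine ⟨v, ?_⟩
        have hv1 : v ∉ S' := fun h => hji (hv ▸ hS'f v h)
        have hv2 : ¬ R v := fun ⟨h, _⟩ => hji (hv ▸ h)
        simp only [hv1, hv2, if_false]
        exact hv
  · have hsub : (Finset.univ.filter fun v =>
        (if v ∈ S' then 0 else if R v then p + 1 else f v) = 0) ⊆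
        (Finset.univ.filter fun v => f v = 0) ∪ S' := by
      intro v hv
      rw [Finset.mem_filter] at hv
      rw [Finset.mem_union, Finset.mem_filter]
      have hv2 := hv.2
      split_ifs at hv2 with h5 h6
      · exact Or.inr h5
      · exact Or.inl ⟨Finset.mem_univ _, hv2⟩
    have h5 := (Finset.card_le_card hsub).trans (Finset.card_union_le _ _)
    have h6 : S'.card ≤ k := Finset.card_image_le.trans hS
    have h7 : (p + 1 - 1) * k = (p - 1) * k + k := by
      obtain ⟨q, rfl⟩ : ∃ q, p = q + 1 := ⟨p - 1, by omega⟩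
      simp only [Nat.add_sub_cancel]
      ring
    exact h5.trans (by omega)
  · intro u v hadj hu hv
    have hu1 : u ∉ S' := fun h => hu (by simp [h])
    have hv1 : v ∉ S' := fun h => hv (by simp [h])
    simp only [hu1, hv1, if_false] at hu hv ⊢
    by_cases hRu : R u <;> by_cases hRv : R v
    · simp [hRu, hRv]
    · simp only [hRv, if_false] at hv
      have hui : f u = i := hRu.1
      have huv := h4 u v hadj (by omega) hv
      exact absurd (hcross u v hadj hRu hv1 (by omega)) hRv
    · simp only [hRu, if_false] at hu
      have hvi : f v = i := hRv.1
      have huv := h4 u v hadj hu (by omega)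
      exact absurd (hcross v u hadj.symm hRv hu1 (by omega)) hRu
    · simp only [hRu, hRv, if_false] at hu hv ⊢
      exact h4 u v hadj hu hv

/-- If `G` has no splitting into `q + 1` classes, it has one into at most `q` robustly connected
classes. -/
lemma exists_robust_splitting [Fintype V] [Nonempty V] {k q : ℕ}
    (hq : ¬ ∃ f, G.IsSplitting k (q + 1) f) :
    ∃ p f, 1 ≤ p ∧ p ≤ q ∧ G.IsSplitting k p f ∧
      ∀ i, 1 ≤ i → i ≤ p → (G.induce {x | f x = i}).IsRobust k := by
  by_contra! hcon
  have : ∀ p, p ≤ q → ∃ f, G.IsSplitting k (p + 1) f := by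
    intro p
    induction p with
    | zero =>
      refine fun _ => ⟨fun _ => 1, by simp, fun i h1 h2 => ?_, by simp, by simp⟩
      obtain ⟨v⟩ := ‹Nonempty V›
      exact ⟨v, show 1 = i by omega⟩
    | succ p ih =>
      intro hp
      obtain ⟨f, hf⟩ := ih (by omega)
      obtain ⟨i, hi, hip, hnr⟩ := hcon (p + 1) f (by omega) (by omega) hf
      exact hf.refine hi hip hnr
  exact hq (this q le_rfl)

/-! ### The upper bound -/

/-- If `w` has at most one neighbour in `U` in the complement of `R`, every set of two vertices of
`U` includes a neighbour of `w` in `R`. -/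
lemma exists_adj_of_card_compl_le_one {V : Type*} [DecidableEq V] {R : SimpleGraph V}
    [DecidableRel Rᶜ.Adj] {U T : Finset V} {w : V} (hw : w ∉ U)
    (h : (U.filter fun u => Rᶜ.Adj w u).card ≤ 1) (hT : T ⊆ U) (hT2 : 2 ≤ T.card) :
    ∃ u ∈ T, R.Adj w u := by
  by_contra! hcon
  have : T ⊆ U.filter fun u => Rᶜ.Adj w u := fun u hu => Finset.mem_filter.2
    ⟨hT hu, by rw [compl_adj]; exact ⟨by rintro rfl; exact hw (hT hu), hcon u hu⟩⟩
  have := Finset.card_le_card this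
  omega

/-- In a colouring without a red cycle of length `2m` and a blue fan, all red degrees exceed `m`
substantially. -/
lemma degree_lower_bound {Q k n m N : ℕ} {R : SimpleGraph (Fin N)} [DecidableRel R.Adj]
    (hcyc : ∀ X : Finset (Fin N), ∀ [DecidableRel (R.induce {x | x ∈ X}).Adj],
      2 * m + 2 * k ≤ X.card → X.card ≤ Q * k →
      (∀ v, m + 2 * k ≤ (R.induce {x | x ∈ X}).degree v) →
      (R.induce {x | x ∈ X}).IsRobust k → False)
    (hfan : ¬ (fanGraph n).IsContained Rᶜ) (hk : 1 ≤ k) (hNQ : N ≤ Q * k)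
    (hN₁ : 2 * n + 2 * m + 40 * k ≤ N) (hN₂ : 4 * m + 40 * k ≤ N) (v : Fin N) :
    m + 20 * k ≤ R.degree v := by
  classical
  by_contra! hlt
  have hdeg : (Rᶜ.neighborFinset v).card = N - 1 - R.degree v := by
    rw [card_neighborFinset_eq_degree, degree_compl, Fintype.card_fin]
  obtain ⟨U, W, hUY, hWY, hUW, hcard, hWn, hind, hone⟩ :=
    exists_independent_of_no_matching (G := Rᶜ) (Y := Rᶜ.neighborFinset v) (n := n)
      (fun ⟨g, hg⟩ => hfan (hg.fanGraph_isContained fun y hy => (mem_neighborFinset _ _ _).1 hy))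
  have hU : ∀ x ∈ U, ∀ y ∈ U, x ≠ y → R.Adj x y := fun x hx y hy hxy => by
    by_contra h
    exact hind x hx y hy (by rw [compl_adj]; exact ⟨hxy, h⟩)
  have hWU : ∀ w ∈ W, ∀ T ⊆ U, 2 ≤ T.card → ∃ u ∈ T, R.Adj w u := fun w hw T hT hT2 =>
    exists_adj_of_card_compl_le_one (Finset.disjoint_right.1 hUW hw) (hone w hw) hT hT2
  have hX : (U ∪ W).card = U.card + W.card := Finset.card_union_of_disjoint hUW
  -- Averaging the two bounds on N gives N ≥ n + 3m + 40k, hence |U| + |W| = |Y| - |W| is at least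
  -- about 2m + 20k. From N ≥ 2n + 2m + 40k, |U| = |Y| - 2|W| is at least about m + 20k.
  refine hcyc (U ∪ W) (by omega) ?_ ?_ (isRobust_induce_of_clique (by omega) hU hWU)
  · have := Finset.card_le_univ (U ∪ W)
    rw [Fintype.card_fin] at this
    omega
  · rintro ⟨x, hx⟩
    have hlow : U.card - 1 ≤ (R.induce {x | x ∈ U ∪ W}).degree ⟨x, hx⟩ := by
      rcases Finset.mem_union.1 hx with hxU | hxW
      · rw [← Finset.card_erase_of_mem hxU]
        refine card_le_degree_induce _ _ fun t ht => ?_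
        rw [Finset.mem_erase] at ht
        exact ⟨Finset.mem_union_left _ ht.2, hU x hxU t ht.2 ht.1.symm⟩
      · have h1 := Finset.card_filter_add_card_filter_not (s := U) (fun u => Rᶜ.Adj x u)
        have h2 := hone x hxW
        refine le_trans (b := (U.filter fun u => ¬ Rᶜ.Adj x u).card) (by omega)
          (card_le_degree_induce _ _ fun t ht => ?_)
        rw [Finset.mem_filter, compl_adj, not_and_not_right] at ht
        refine ⟨Finset.mem_union_left _ ht.1, ht.2 ?_⟩
        rintro rfl
        exact Finset.disjoint_left.1 hUW ht.1 hxW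
    omega

/-- The Ramsey number of `C_{2m}` and `F_n` exceeds `max (2n + 2m) (4m)` by little. -/
theorem ramseyArrows_of_le (Q : ℕ) : ∃ k₀, ∀ k, k₀ ≤ k → ∀ n m N : ℕ, k ≤ m → n ≤ 2 * m + 1 →
    N ≤ Q * k → N ≤ 6 * m + 60 * k → 2 * n + 2 * m + 40 * k ≤ N → 4 * m + 40 * k ≤ N →
    RamseyArrows (cycleGraph (2 * m)) (fanGraph n) N := by
  classical
  obtain ⟨k₀, hk₀⟩ := exists_even_cycle Q
  refine ⟨k₀ + 1, ?_⟩
  intro k hk n m N hkm hnm hNQ hN₀ hN₁ hN₂ R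
  by_contra hcon
  obtain ⟨hred, hfan⟩ := not_or.1 hcon
  have hcyc : ∀ X : Finset (Fin N), ∀ [DecidableRel (R.induce {x | x ∈ X}).Adj],
      2 * m + 2 * k ≤ X.card → X.card ≤ Q * k →
      (∀ v, m + 2 * k ≤ (R.induce {x | x ∈ X}).degree v) →
      (R.induce {x | x ∈ X}).IsRobust k → False := by
    intro X _ h1 h2 h3 h4
    have hX : Fintype.card {x | x ∈ X} = X.card := Fintype.card_coe X
    have := hk₀ k (by omega) (R.induce {x | x ∈ X}) m hkm (by omega) (by omega) h3 h4
    exact hred (this.trans ⟨(Embedding.induce _).toCopy⟩)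
  have hdeg := degree_lower_bound hcyc hfan (by omega) hNQ hN₁ hN₂
  have : Nonempty (Fin N) := ⟨⟨0, by omega⟩⟩
  have hclass : ∀ p f, R.IsSplitting k p f → p ≤ 7 → ∀ v, f v ≠ 0 →
      m + 14 * k ≤ ((Finset.univ.filter fun x => f x = f v) ∩ R.neighborFinset v).card := by
    intro p f hf hp v hv
    have h1 := hdeg v
    rw [← card_neighborFinset_eq_degree] at h1
    have h2 : (R.neighborFinset v).card ≤
        ((Finset.univ.filter fun x => f x = f v) ∩ R.neighborFinset v).card +
        (Finset.univ.filter fun x => f x = 0).card := by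
      refine (Finset.card_le_card ?_).trans (Finset.card_union_le _ _)
      intro x hx
      by_cases h0 : f x = 0
      · exact Finset.mem_union_right _ (by simp [h0])
      · refine Finset.mem_union_left _ (Finset.mem_inter.2 ⟨?_, hx⟩)
        simpa using (hf.2.2.2 v x ((mem_neighborFinset _ _ _).1 hx) hv h0).symm
    have h3 := hf.2.2.1
    have h4 : (p - 1) * k ≤ 6 * k := Nat.mul_le_mul_right _ (by omega)
    omega
  have hclass' : ∀ p f, R.IsSplitting k p f → p ≤ 7 → ∀ i, 1 ≤ i → i ≤ p →
      m + 14 * k ≤ (Finset.univ.filter fun x => f x = i).card := by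
    intro p f hf hp i hi hip
    obtain ⟨v, rfl⟩ := hf.2.1 i hi hip
    exact (hclass p f hf hp v (by omega)).trans (Finset.card_le_card Finset.inter_subset_left)
  have hsum : ∀ p f, R.IsSplitting k p f →
      N = ∑ i ∈ Finset.Icc 1 p, (Finset.univ.filter fun x => f x = i).card +
        (Finset.univ.filter fun x => f x = 0).card := by
    intro p f hf
    have h1 := Finset.card_eq_sum_card_fiberwise (s := (Finset.univ : Finset (Fin N))) (f := f)
      (t := Finset.range (p + 1)) (fun x _ => by
        have := hf.1 x
        simp only [Finset.coe_range, Set.mem_Iio]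
        omega)
    rw [Finset.card_univ, Fintype.card_fin] at h1
    rw [Finset.range_eq_Ico, Finset.sum_eq_sum_Ico_succ_bot (by omega), add_comm] at h1
    exact h1
  -- Seven classes would need at least 7(m + 14k) vertices, more than the permitted 6m + 60k.
  obtain ⟨p, f, hp1, hp6, hf, hrob⟩ := exists_robust_splitting (G := R) (k := k) (q := 6) (by
    rintro ⟨f, hf⟩
    have h1 := hsum 7 f hf
    have h2 := Finset.card_nsmul_le_sum (Finset.Icc 1 7)
      (fun i => (Finset.univ.filter fun x => f x = i).card) (m + 14 * k) (fun i hi => by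
        rw [Finset.mem_Icc] at hi
        exact hclass' 7 f hf le_rfl i hi.1 hi.2)
    simp only [Nat.card_Icc, smul_eq_mul] at h2
    omega)
  set c : ℕ → ℕ := fun i => (Finset.univ.filter fun x => f x = i).card with hc
  have hN : N = ∑ i ∈ Finset.Icc 1 p, c i + c 0 := hsum p f hf
  have hc0 : c 0 ≤ 5 * k := hf.2.2.1.trans (Nat.mul_le_mul_right _ (by omega))
  have hsmall : ∀ i ∈ Finset.Icc 1 p, c i ≤ 2 * m + 2 * k := by
    intro i hi
    rw [Finset.mem_Icc] at hi
    by_contra! hbig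
    have heq : {x | x ∈ Finset.univ.filter fun x => f x = i} = {x | f x = i} := by
      ext x
      simp
    refine hcyc (Finset.univ.filter fun x => f x = i) hbig.le ?_ ?_ ?_
    · have := Finset.card_le_univ (Finset.univ.filter fun x => f x = i)
      rw [Fintype.card_fin] at this
      omega
    · rintro ⟨v, hv⟩
      have hvi : f v = i := by simpa using hv
      have h1 := hclass p f hf (by omega) v (by omega)
      refine le_trans (b := ((Finset.univ.filter fun x => f x = f v) ∩
        R.neighborFinset v).card) (by omega) (card_le_degree_induce _ _ fun t ht => ?_)
      rw [Finset.mem_inter, mem_neighborFinset] at ht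
      exact ⟨hvi ▸ ht.1, ht.2⟩
    · rw [heq]
      exact hrob i hi.1 hi.2
  -- Two classes and class 0 together have at most 4m + 9k vertices.
  have hp3 : 3 ≤ p := by
    by_contra! hlt
    have h2 : ∑ i ∈ Finset.Icc 1 p, c i ≤ _ := Finset.sum_le_card_nsmul _ _ _ hsmall
    simp only [Nat.card_Icc, smul_eq_mul, Nat.add_sub_cancel] at h2
    have h3 := Nat.mul_le_mul_right (2 * m + 2 * k) (show p ≤ 2 by omega)
    omega
  obtain ⟨i₀, hi₀, hmin⟩ := Finset.exists_min_image (Finset.Icc 1 p) c ⟨1, by simp; omega⟩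
  have hi₀' := Finset.mem_Icc.1 hi₀
  obtain ⟨v, hv⟩ := hf.2.1 i₀ hi₀'.1 hi₀'.2
  set Y := Finset.univ.filter fun x => f x ≠ 0 ∧ f x ≠ i₀ with hY
  have hYm : ∀ x ∈ Y, f x ≠ 0 ∧ f x ≠ i₀ := fun x hx => (Finset.mem_filter.1 hx).2
  have hYcard : Y.card = ∑ i ∈ (Finset.Icc 1 p).erase i₀, c i := by
    rw [Finset.card_eq_sum_card_fiberwise (s := Y) (f := f) (t := (Finset.Icc 1 p).erase i₀)]
    · refine Finset.sum_congr rfl fun i hi => ?_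
      rw [Finset.mem_erase, Finset.mem_Icc] at hi
      rw [hc, hY, Finset.filter_filter]
      congr 1
      refine Finset.filter_congr fun x _ => ?_
      omega
    · intro x hx
      have h1 := hYm x hx
      have h2 := hf.1 x
      simp only [Finset.coe_erase, Finset.coe_Icc, Set.mem_sdiff, Set.mem_Icc,
        Set.mem_singleton_iff]
      omega
  have hsplit : c i₀ + Y.card + c 0 = N := by
    rw [hYcard, Finset.add_sum_erase _ _ hi₀]
    exact hN.symm
  have hY2 : 2 * c i₀ ≤ Y.card := by
    have h1 := Finset.card_nsmul_le_sum ((Finset.Icc 1 p).erase i₀) c (c i₀)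
      (fun i hi => hmin i (Finset.mem_of_mem_erase hi))
    rw [← hYcard, Finset.card_erase_of_mem hi₀, Nat.card_Icc, smul_eq_mul] at h1
    exact (Nat.mul_le_mul_right _ (by omega)).trans h1
  obtain ⟨U, W, hUY, hWY, hUW, hcard, hWn, hind, hone⟩ :=
    exists_independent_of_no_matching (G := Rᶜ) (Y := Y) (n := n)
      (fun ⟨g, hg⟩ => hfan (hg.fanGraph_isContained (v := v) fun y hy => by
        have hy' := hYm y hy
        rw [compl_adj]
        refine ⟨fun h => hy'.2 (h ▸ hv), fun h => hy'.2 ?_⟩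
        rw [← hv]
        exact (hf.2.2.2 v y h (by omega) hy'.1).symm))
  -- `hY2` gives |Y| ≥ 2(N - 5k)/3, and n ≤ 2m + 1 turns the bound on N into N ≥ 3n - 1 + 40k, so
  -- |Y| exceeds 2n > 2|W| comfortably.
  have hU2 : 2 ≤ U.card := by omega
  obtain ⟨u₀, hu₀⟩ := Finset.card_pos.1 (show 0 < U.card by omega)
  have hUf : ∀ x ∈ U, f x = f u₀ := by
    intro x hx
    by_cases hxu : x = u₀
    · rw [hxu]
    · by_contra hne
      refine hind x hx u₀ hu₀ (by
        rw [compl_adj]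
        exact ⟨hxu, fun h => hne (hf.2.2.2 x u₀ h (hYm x (hUY hx)).1 (hYm u₀ (hUY hu₀)).1)⟩)
  have hWf : ∀ x ∈ W, f x = f u₀ := by
    intro x hx
    obtain ⟨u, hu, hadj⟩ := exists_adj_of_card_compl_le_one (Finset.disjoint_right.1 hUW hx)
      (hone x hx) subset_rfl hU2
    rw [← hUf u hu]
    exact hf.2.2.2 x u hadj (hYm x (hWY hx)).1 (hYm u (hUY hu)).1
  have hj : f u₀ ∈ (Finset.Icc 1 p).erase i₀ := by
    have h1 := hYm u₀ (hUY hu₀)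
    have h2 := hf.1 u₀
    rw [Finset.mem_erase, Finset.mem_Icc]
    omega
  have hUWc : U.card + W.card ≤ c (f u₀) := by
    rw [← Finset.card_union_of_disjoint hUW]
    refine Finset.card_le_card fun x hx => ?_
    rw [Finset.mem_filter]
    exact ⟨Finset.mem_univ _, (Finset.mem_union.1 hx).elim (hUf x) (hWf x)⟩
  -- A third class exists and is at least as large as the smallest one.
  have hthird : c i₀ + c (f u₀) ≤ Y.card := by
    have h1 := Finset.card_nsmul_le_sum (((Finset.Icc 1 p).erase i₀).erase (f u₀)) c (c i₀)
      (fun i hi => hmin i (Finset.mem_of_mem_erase (Finset.mem_of_mem_erase hi)))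
    rw [Finset.card_erase_of_mem hj, Finset.card_erase_of_mem hi₀, Nat.card_Icc, smul_eq_mul] at h1
    rw [hYcard, ← Finset.add_sum_erase _ _ hj, add_comm]
    refine Nat.add_le_add_left (le_trans ?_ h1) _
    exact Nat.le_mul_of_pos_left _ (by omega)
  -- By `hUWc`, |Y| - |W| ≤ c (f u₀), so `hthird` yields c i₀ ≤ |W| < n. Thus N = c 0 + c i₀ + |Y| <
  -- 5k + 2n + (2m + 2k), a contradiction.
  have := hsmall (f u₀) (Finset.mem_of_mem_erase hj)
  omega

/-! ### Lower-bound colourings -/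

/-- The graph whose edges join the distinct vertices of the same class of `f`. -/
def sameClass {V ι : Type*} (f : V → ι) : SimpleGraph V where
  Adj u v := u ≠ v ∧ f u = f v
  symm := ⟨fun _ _ h => ⟨h.1.symm, h.2.symm⟩⟩
  loopless := ⟨fun _ h => h.1 rfl⟩

/-- A cycle is connected, so its copy stays inside one class, which is too small. -/
lemma not_cycleGraph_isContained_sameClass {V ι : Type*} [Fintype V] [DecidableEq ι] {f : V → ι}
    {l : ℕ} (hl : 0 < l) (hf : ∀ i, (Finset.univ.filter fun v => f v = i).card < l) :
    ¬ (cycleGraph l).IsContained (sameClass f) := by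
  classical
  rintro ⟨φ⟩
  have hconst : ∀ i j, f (φ i) = f (φ j) := by
    intro i j
    obtain ⟨p⟩ := cycleGraph_preconnected i j
    induction p with
    | nil => rfl
    | cons h _ ih => exact (φ.toHom.map_adj h).2.trans ih
  refine absurd (hf (f (φ ⟨0, hl⟩))) (not_lt.2 ?_)
  calc l = (Finset.univ.image φ).card := by
        rw [Finset.card_image_of_injective (f := φ) _ φ.injective, Finset.card_univ,
          Fintype.card_fin]
    _ ≤ _ := by
        refine Finset.card_le_card fun x hx => ?_
        obtain ⟨i, -, rfl⟩ := Finset.mem_image.1 hx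
        simpa using hconst i ⟨0, hl⟩

/-- Each triangle of the fan meets all three classes, so the n triangles need n distinct vertices in
each class not containing the centre. -/
lemma not_fanGraph_isContained_sameClass_compl {V : Type*} [Fintype V] {f : V → Fin 3} {n : ℕ}
    (hf : ∀ v, ∃ q, q ≠ f v ∧ (Finset.univ.filter fun x => f x = q).card < n) :
    ¬ (fanGraph n).IsContained (sameClass f)ᶜ := by
  classical
  rintro ⟨φ⟩
  have hadj : ∀ x y, (fanGraph n).Adj x y → f (φ x) ≠ f (φ y) := by
    intro x y hxy hcon
    have := φ.toHom.map_adj hxy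
    rw [compl_adj] at this
    exact this.2 ⟨this.1, hcon⟩
  obtain ⟨q, hq, hcard⟩ := hf (φ none)
  have hβ : ∀ i : Fin n, ∃ b, f (φ (some (i, b))) = q := by
    intro i
    have h1 := hadj none (some (i, false)) trivial
    have h2 := hadj none (some (i, true)) trivial
    have h3 := hadj (some (i, false)) (some (i, true)) ⟨rfl, by simp⟩
    by_contra! hcon
    have h4 := hcon false
    have h5 := hcon true
    omega
  choose β hβ using hβ
  refine absurd hcard (not_lt.2 ?_)
  calc n = (Finset.univ.image fun i => φ (some (i, β i))).card := by
        rw [Finset.card_image_of_injective, Finset.card_univ, Fintype.card_fin]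
        intro i j hij
        have := Option.some.inj (φ.injective hij)
        exact (Prod.ext_iff.1 this).1
    _ ≤ _ := by
        refine Finset.card_le_card fun x hx => ?_
        obtain ⟨i, -, rfl⟩ := Finset.mem_image.1 hx
        simpa using hβ i

/-- The classes are consecutive intervals of lengths at most x, y, z. The third is the scarce class
for centres in the first two; for centres in the third it is the second, unless the third is empty.
-/
lemma not_ramseyArrows {x y z N m n : ℕ} (hN : N ≤ x + y + z) (hm : 0 < m) (hx : x < 2 * m)
    (hy : y < 2 * m) (hz : z < 2 * m) (hzn : z < n) (hyz : y < n ∨ z = 0) :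
    ¬ RamseyArrows (cycleGraph (2 * m)) (fanGraph n) N := by
  intro h
  set f : Fin N → Fin 3 := fun i => if i.val < x then 0 else if i.val < x + y then 1 else 2 with hf
  have hIco : ∀ (q : Fin 3) (s t : ℕ), (∀ i, f i = q → s ≤ i.val ∧ i.val < t) →
      (Finset.univ.filter fun i => f i = q).card ≤ t - s := by
    intro q s t hst
    rw [← Nat.card_Ico, ← Finset.card_map Fin.valEmbedding]
    refine Finset.card_le_card fun i hi => ?_
    obtain ⟨j, hj, rfl⟩ := Finset.mem_map.1 hi
    exact Finset.mem_Ico.2 (hst j (Finset.mem_filter.1 hj).2)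
  have h0 : (Finset.univ.filter fun i => f i = 0).card ≤ x := hIco 0 0 x fun i hi => by
    simp only [hf] at hi
    split_ifs at hi <;> simp_all
  have h1 : (Finset.univ.filter fun i => f i = 1).card ≤ y := by
    refine (hIco 1 x (x + y) fun i hi => ?_).trans (by omega)
    simp only [hf] at hi
    split_ifs at hi <;> simp_all
  have hlast : ∀ i, f i = 2 → x + y ≤ i.val ∧ i.val < x + y + z := fun i hi => by
    have := i.2
    simp only [hf] at hi
    split_ifs at hi with h3 h4
    · simp at hi
    · simp at hi
    · omega
  have h2 : (Finset.univ.filter fun i => f i = 2).card ≤ z :=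
    (hIco 2 (x + y) (x + y + z) hlast).trans (by omega)
  rcases h (sameClass f) with hred | hblue
  · refine not_cycleGraph_isContained_sameClass (by omega) (fun i => ?_) hred
    fin_cases i
    · exact h0.trans_lt hx
    · exact h1.trans_lt hy
    · exact h2.trans_lt hz
  · refine not_fanGraph_isContained_sameClass_compl (fun v => ?_) hblue
    by_cases hv : f v = 2
    · rcases hyz with hyn | hz0
      · exact ⟨1, by rw [hv]; decide, h1.trans_lt hyn⟩
      · have := hlast v hv
        omega
    · exact ⟨2, Ne.symm hv, h2.trans_lt hzn⟩

end SimpleGraph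

/-! ### From finite bounds to the asymptotic formula -/

lemma lt_ramseyNumber {V W : Type} {F : SimpleGraph V} {H : SimpleGraph W} {N₀ N₁ : ℕ}
    (h₀ : ∀ N ≤ N₀, ¬ RamseyArrows F H N) (hpos : 0 < N₁) (h₁ : RamseyArrows F H N₁) :
    N₀ < ramseyNumber F H := by
  by_contra! hle
  -- An empty infimum would be 0; the witness `N₁` ensures that the infimum is attained.
  have hmem : ramseyNumber F H ∈ {N : ℕ | 0 < N ∧ RamseyArrows F H N} :=
    csInf_mem ⟨N₁, hpos, h₁⟩
  exact h₀ _ hle hmem.2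

lemma ramseyNumber_le {V W : Type} {F : SimpleGraph V} {H : SimpleGraph W} {N : ℕ}
    (hpos : 0 < N) (h : RamseyArrows F H N) : ramseyNumber F H ≤ N :=
  Nat.sInf_le ⟨hpos, h⟩

/-- Up to an error of `40k` with `k` linear in `n`, the Ramsey number of `C_{2m}` and `F_n` is
`max (2n + 2m) (4m)`. -/
theorem ramseyNumber_bounds (Q : ℕ) : ∃ k₀, ∀ k, k₀ ≤ k → ∀ n m : ℕ, 0 < n → k ≤ m →
    n ≤ 2 * m + 1 → max (2 * n + 2 * m) (4 * m) + 40 * k ≤ Q * k →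
    ramseyNumber (SimpleGraph.cycleGraph (2 * m)) (fanGraph n) ≤
      max (2 * n + 2 * m) (4 * m) + 40 * k ∧
    max (2 * n + 2 * m) (4 * m) ≤
      ramseyNumber (SimpleGraph.cycleGraph (2 * m)) (fanGraph n) + 9 := by
  obtain ⟨k₀, hk₀⟩ := SimpleGraph.ramseyArrows_of_le Q
  refine ⟨k₀ + 1, fun k hk n m hn hkm hnm hQ => ?_⟩
  have harr := hk₀ k (by omega) n m _ hkm hnm hQ (by omega) (by omega) (by omega)
  refine ⟨ramseyNumber_le (by omega) harr, ?_⟩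
  rcases le_total (2 * n + 2 * m) (4 * m) with hle | hle
  · have := lt_ramseyNumber (N₀ := (2 * m - 1) + (2 * m - 1) + 0) (fun N hN =>
      SimpleGraph.not_ramseyArrows hN (by omega) (by omega) (by omega) (by omega) (by omega)
        (Or.inr rfl)) (by omega) harr
    omega
  -- The minimum keeps the two small cliques below 2m as well; since n ≤ 2m + 1, this costs only a
  -- constant.
  · have := lt_ramseyNumber (N₀ := (2 * m - 1) + min (n - 1) (2 * m - 1) + min (n - 1) (2 * m - 1))
      (fun N hN => SimpleGraph.not_ramseyArrows hN (by omega) (by omega) (by omega) (by omega)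
        (by omega) (Or.inl (by omega))) (by omega) harr
    omega

open Filter Topology in
/-- A sequence within `e n` of `t n` for every `e > 0` is `(t + o(1)) n`. -/
lemma exists_tendsto_zero_of_eventually_abs_le {r : ℕ → ℝ} {t : ℝ}
    (h : ∀ e > 0, ∀ᶠ n : ℕ in atTop, |r n - t * n| ≤ e * n) :
    ∃ ε : ℕ → ℝ, Tendsto ε atTop (𝓝 0) ∧ ∀ᶠ n : ℕ in atTop, r n = (t + ε n) * n := by
  refine ⟨fun n => r n / n - t, ?_, ?_⟩
  · rw [Metric.tendsto_atTop']
    intro e he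
    obtain ⟨n₀, hn₀⟩ := eventually_atTop.1 (h (e / 2) (by positivity))
    refine ⟨n₀, fun n hn => ?_⟩
    have hpos : (0 : ℝ) < n := by exact_mod_cast (Nat.zero_le n₀).trans_lt hn
    have h1 := hn₀ n hn.le
    rw [Real.dist_eq, sub_zero]
    have h2 : r n / n - t = (r n - t * n) / n := by field_simp
    rw [h2, abs_div, abs_of_pos hpos, div_lt_iff₀ hpos]
    nlinarith
  · filter_upwards [eventually_gt_atTop 0] with n hn
    have hpos : (n : ℝ) ≠ 0 := by positivity
    field_simp
    ring

open Filter in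
/-- The asymptotic behaviour of the Ramsey number of `C_{2⌊an⌋}` and `F_n`. -/
lemma eventually_abs_ramseyNumber_sub_le {a : ℝ} (ha : 1 / 2 ≤ a) {e : ℝ} (he : 0 < e) :
    ∀ᶠ n : ℕ in atTop,
      |(ramseyNumber (SimpleGraph.cycleGraph (2 * ⌊a * (n : ℝ)⌋₊)) (fanGraph n) : ℝ)
        - max (2 + 2 * a) (4 * a) * n| ≤ e * n := by
  set t := max (2 + 2 * a) (4 * a) with ht
  have ht0 : 0 < t := lt_of_lt_of_le (by linarith) (le_max_left _ _)
  -- With k = ⌊ηn⌋, the upper error 40k is at most en, and η ≤ 1/4 ensures k ≤ m. The 13 in the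
  -- threshold below is 9 from the lower bound plus 4 from rounding an down to m.
  obtain ⟨η, hη, hη4, hηe⟩ : ∃ η : ℝ, 0 < η ∧ η ≤ 1 / 4 ∧ 40 * η ≤ e :=
    ⟨min (1 / 4) (e / 40), by positivity, min_le_left _ _, by
      have := min_le_right (1 / 4) (e / 40)
      linarith⟩
  obtain ⟨Q, hQ⟩ := exists_nat_ge (2 * (t + 10) / η)
  obtain ⟨k₀, hk₀⟩ := ramseyNumber_bounds Q
  filter_upwards [eventually_ge_atTop ⌈(k₀ + 2) / η⌉₊, eventually_ge_atTop ⌈13 / e⌉₊,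
    eventually_ge_atTop 8] with n h1 h2 h3
  rw [Nat.ceil_le, div_le_iff₀ hη] at h1
  rw [Nat.ceil_le, div_le_iff₀ he] at h2
  have h3' : (8 : ℝ) ≤ n := by exact_mod_cast h3
  set m := ⌊a * (n : ℝ)⌋₊ with hm
  set k := ⌊η * (n : ℝ)⌋₊ with hk
  have hm1 : (m : ℝ) ≤ a * n := Nat.floor_le (by positivity)
  have hm2 : a * n < m + 1 := Nat.lt_floor_add_one _
  have hk1 : (k : ℝ) ≤ η * n := Nat.floor_le (by positivity)
  have hk2 : η * n < k + 1 := Nat.lt_floor_add_one _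
  have hk00 : (0 : ℝ) ≤ k₀ := Nat.cast_nonneg _
  have hkk : k₀ ≤ k := by
    have : (k₀ : ℝ) ≤ k := by linarith
    exact_mod_cast this
  have hkm : k ≤ m := by
    have : (k : ℝ) ≤ m := by nlinarith
    exact_mod_cast this
  have hnm : n ≤ 2 * m + 1 := by
    have : (n : ℝ) < 2 * m + 1 + 1 := by nlinarith
    have : n < 2 * m + 1 + 1 := by exact_mod_cast this
    omega
  have hmax : (max (2 * n + 2 * m) (4 * m) : ℝ) ≤ t * n := by
    refine max_le ?_ ?_
    · have := le_max_left (2 + 2 * a) (4 * a)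
      nlinarith
    · have := le_max_right (2 + 2 * a) (4 * a)
      nlinarith
  have hmax' : t * n ≤ (max (2 * n + 2 * m) (4 * m) : ℝ) + 4 := by
    rw [ht, max_mul_of_nonneg _ _ (by positivity)]
    refine max_le ?_ ?_
    · have := le_max_left (2 * n + 2 * m : ℝ) (4 * m)
      nlinarith
    · have := le_max_right (2 * n + 2 * m : ℝ) (4 * m)
      nlinarith
  have hQk : max (2 * n + 2 * m) (4 * m) + 40 * k ≤ Q * k := by
    have hQ' : 2 * (t + 10) ≤ Q * η := (div_le_iff₀ hη).1 hQ
    have hkn : η * n ≤ 2 * k := by linarith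
    have h4 : (max (2 * n + 2 * m) (4 * m) : ℝ) + 40 * k ≤ Q * k := by
      have h5 : (40 * k : ℝ) ≤ 10 * n := by nlinarith
      have h6 : 2 * (t + 10) * n ≤ Q * (2 * k) := by
        calc 2 * (t + 10) * n ≤ Q * η * n := by gcongr
          _ = Q * (η * n) := by ring
          _ ≤ Q * (2 * k) := by gcongr
      nlinarith
    exact_mod_cast h4
  obtain ⟨hup, hlow⟩ := hk₀ k hkk n m (by omega) hkm hnm hQk
  have hup' : (ramseyNumber (SimpleGraph.cycleGraph (2 * m)) (fanGraph n) : ℝ) ≤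
      max (2 * n + 2 * m : ℝ) (4 * m) + 40 * k := by exact_mod_cast hup
  have hlow' : max (2 * n + 2 * m : ℝ) (4 * m) ≤
      ramseyNumber (SimpleGraph.cycleGraph (2 * m)) (fanGraph n) + 9 := by exact_mod_cast hlow
  rw [abs_le]
  constructor <;> nlinarith

theorem theorem1 (a : ℝ) (ha : 1 / 2 ≤ a) :
    (a < 1 → ∃ ε : ℕ → ℝ, Filter.Tendsto ε Filter.atTop (nhds 0) ∧
      ∀ᶠ n : ℕ in Filter.atTop,
        (ramseyNumber (SimpleGraph.cycleGraph (2 * ⌊a * (n : ℝ)⌋₊)) (fanGraph n) : ℝ)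
          = (2 + 2 * a + ε n) * n) ∧
    (1 ≤ a → ∃ ε : ℕ → ℝ, Filter.Tendsto ε Filter.atTop (nhds 0) ∧
      ∀ᶠ n : ℕ in Filter.atTop,
        (ramseyNumber (SimpleGraph.cycleGraph (2 * ⌊a * (n : ℝ)⌋₊)) (fanGraph n) : ℝ)
          = (4 * a + ε n) * n) := by
  have h := exists_tendsto_zero_of_eventually_abs_le
    fun e he => eventually_abs_ramseyNumber_sub_le ha he
  constructor
  · intro ha1
    rwa [max_eq_left (by linarith)] at h
  · intro ha1
    rwa [max_eq_right (by linarith)] at h
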